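/- Let $\tilde D\subset D\subset B$ be Banach spaces (over $\mathbb R$ or $\mathbb C$) with $\|\cdot\|_{\tilde D}\ge\|\cdot\|_D\ge\|\cdot\|_B$ and with $\tilde D$ dense in both $D$ and $B$. Let $A(x)$, $x\in\mathbb R$, be a family of operators that is uniformly bounded and strongly continuous in $x$ both in $\mathcal L(D,B)$ and in $\mathcal L(\tilde D,D)$. Suppose that every $A(x)$ generates a strongly continuous semigroup $e^{tA(x)}$ in $B$ with the common core $D$, which restricts to a strongly continuous semigroup in $D$ with the common core $\tilde D$ and to a semigroup of bounded operators in $\tilde D$. Suppose further that, in each of the three spaces, $\|e^{tA(x)}\|$ is bounded uniformly in $x\in\mathbb R$ and in $t$ from any compact segment of $[0,\infty)$. Let $\nu$ be a finite (positive) Borel measure on $(0,\infty)$ with total mass $\|\nu\|$, and let $$D^{(\nu)}_+f(x)=-\int_0^\infty (f(x-y)-f(x))\,\nu(dy).$$ Write $C_\infty(\mathbb R,E)$ for the Banach space of continuous functions $\mathbb R\to E$ vanishing at infinity, with the sup-norm. For $t\ge 0$ let $PC(t)$ be the set of all data consisting of a number $n\ge 0$ of jumps, jump times $0<s_1<\dots<s_n<t$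 and jump sizes $z_1,\dots,z_n\in\mathbb R$. Such data determine, for every $x\in\mathbb R$, the piecewise constant path $Z_x(\tau)=x-\sum_{k:\,s_k\le\tau}z_k$, $0\le\tau\le t$. Let $\nu^{PC}$ be the measure on $PC(t)$ that equals $ds_1\cdots ds_n\,\nu(dz_1)\cdots\nu(dz_n)$ on the data with $n$ jumps, let $\tilde\nu^{PC}=e^{-t\|\nu\|}\nu^{PC}$, and let $\mathbf E_\nu$ denote integration with respect to $\tilde\nu^{PC}$. (Under $\tilde\nu^{PC}$, $x-Z_x$ is the compound Poisson process with jump measure $\nu$ on $[0,t]$.) For such a path the backward chronological exponential is the time-ordered product $$T\exp\Big\{\int_0^tA(Z_x(\tau))\,d\tau\Big\}=e^{s_1A(x)}\,e^{(s_2-s_1)A(Z_x(s_1))}\cdots e^{(t-s_n)A(Z_x(s_n))}$$ (which is $e^{tA(x)}$ if $n=0$). Then $\tilde\nu^{PC}$ is a probability measure for every $t\ge 0$, and there is a unique strongly continuous semigroup $(\Phi_t)_{t\ge0}$ in $C_\infty(\mathbb R,B)$ whose generator is the closure of the operator $A(\cdot)-D^{(\nu)}_+$ with the domain $C_\infty(\mathbb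 R,D)$. Moreover: 1. For every $Y\in C_\infty(\mathbb R,D)$, $\mu_t=\Phi_tY$ is the unique solution of the Cauchy problem $$\partial_t\mu_t(x)=A(x)\mu_t(x)-D^{(\nu)}_+\mu_t(x),\qquad \mu_0=Y,\qquad t\ge 0,$$ in the class of functions $[0,\infty)\to C_\infty(\mathbb R,D)$ that are differentiable in $t$ in the norm of $C_\infty(\mathbb R,B)$ (one-sidedly at $t=0$). 2. For every $Y\in C_\infty(\mathbb R,B)$, $t\ge 0$ and $x\in\mathbb R$, the function $T\exp\{\int_0^tA(Z_x(\tau))\,d\tau\}\,Y(Z_x(t))$ is Bochner integrable on $PC(t)$ with respect to $\tilde\nu^{PC}$, and $$\Phi_tY(x)=\mathbf E_\nu\Big[T\exp\Big\{\int_0^tA(Z_x(\tau))\,d\tau\Big\}\,Y(Z_x(t))\Big].$$ -/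

import Mathlib

open MeasureTheory Filter Topology Set
open scoped NNReal ZeroAtInfty

noncomputable section

namespace ChronPath

/-- A strongly continuous one-parameter semigroup of bounded linear operators on `E`. -/
structure IsC0Semigroup {𝕜 E : Type*} [RCLike 𝕜] [NormedAddCommGroup E] [NormedSpace 𝕜 E]
    (S : ℝ≥0 → E →L[𝕜] E) : Prop where
  map_zero : S 0 = 1
  map_add : ∀ s t, S (s + t) = S s * S t
  cont : ∀ f, Continuous fun t => S t f

/-- The graph of the infinitesimal generator of `S`: the pairs `(f, g)` such that
`(S t f - f) / t → g` in norm as `t → 0+`. -/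
def generatorGraph {𝕜 E : Type*} [RCLike 𝕜] [NormedAddCommGroup E] [NormedSpace 𝕜 E]
    (S : ℝ≥0 → E →L[𝕜] E) : Set (E × E) :=
  {p | Tendsto (fun t : ℝ≥0 => (((t : ℝ) : 𝕜))⁻¹ • (S t p.1 - p.1)) (𝓝[>] 0) (𝓝 p.2)}

/-- Uniform boundedness of a family of semigroups, in `x ∈ ℝ` and in `t` from any compact
segment. -/
def UnifBounded {𝕜 E : Type*} [RCLike 𝕜] [NormedAddCommGroup E] [NormedSpace 𝕜 E]
    (S : ℝ → ℝ≥0 → E →L[𝕜] E) : Prop :=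
  ∀ T : ℝ≥0, ∃ C : ℝ, ∀ x, ∀ t ≤ T, ‖S x t‖ ≤ C

/-- A uniformly bounded, strongly continuous family of bounded operators. -/
def UnifBoundedStronglyCont {𝕜 E F : Type*} [RCLike 𝕜] [NormedAddCommGroup E] [NormedSpace 𝕜 E]
    [NormedAddCommGroup F] [NormedSpace 𝕜 F] (A : ℝ → E →L[𝕜] F) : Prop :=
  (∃ C : ℝ, ∀ x, ‖A x‖ ≤ C) ∧ ∀ f, Continuous fun x => A x f

/-- Three spaces `Dt ⊂ D ⊂ B`, the inclusions being `j : Dt → D` and `i : D → B`, with ordered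
norms and with `Dt` dense in both `D` and `B`. -/
structure ThreeSpaces {𝕜 B D Dt : Type*} [RCLike 𝕜]
    [NormedAddCommGroup B] [NormedSpace 𝕜 B] [NormedAddCommGroup D] [NormedSpace 𝕜 D]
    [NormedAddCommGroup Dt] [NormedSpace 𝕜 Dt] (j : Dt →L[𝕜] D) (i : D →L[𝕜] B) : Prop where
  inj_j : Function.Injective j
  inj_i : Function.Injective i
  norm_j : ∀ d, ‖j d‖ ≤ ‖d‖
  norm_i : ∀ d, ‖i d‖ ≤ ‖d‖
  dense_D : DenseRange j
  dense_B : DenseRange fun d => i (j d)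

/-- The assumptions on the family `A x : D → B`.  Here `A₁ x : Dt → D` is the restriction of
`A x` to `Dt`, `S x t = e^{t A(x)}` is the semigroup in `B`, and `SD x t`, `SDt x t` are its
restrictions to `D` and to `Dt`.  That `A x` generates `S x` with core `D` means that the
generator of `S x` is the closure of `A x` with the domain `D`; likewise for `SD x` and `Dt`. -/
structure GeneratingFamily {𝕜 B D Dt : Type*} [RCLike 𝕜]
    [NormedAddCommGroup B] [NormedSpace 𝕜 B] [NormedAddCommGroup D] [NormedSpace 𝕜 D]
    [NormedAddCommGroup Dt] [NormedSpace 𝕜 Dt] (j : Dt →L[𝕜] D) (i : D →L[𝕜] B)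
    (A : ℝ → D →L[𝕜] B) (A₁ : ℝ → Dt →L[𝕜] D)
    (S : ℝ → ℝ≥0 → B →L[𝕜] B) (SD : ℝ → ℝ≥0 → D →L[𝕜] D)
    (SDt : ℝ → ℝ≥0 → Dt →L[𝕜] Dt) : Prop where
  bdd_A : UnifBoundedStronglyCont A
  bdd_A₁ : UnifBoundedStronglyCont A₁
  restrict_A : ∀ x d, i (A₁ x d) = A x (j d)
  semigroup_B : ∀ x, IsC0Semigroup (S x)
  bdd_B : UnifBounded S
  core_B : ∀ x, generatorGraph (S x) = closure (range fun d : D => (i d, A x d))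
  restrict_D : ∀ x t d, i (SD x t d) = S x t (i d)
  semigroup_D : ∀ x, IsC0Semigroup (SD x)
  bdd_D : UnifBounded SD
  core_D : ∀ x, generatorGraph (SD x) = closure (range fun d : Dt => (j d, A₁ x d))
  restrict_Dt : ∀ x t d, j (SDt x t d) = SD x t (j d)
  bdd_Dt : UnifBounded SDt

/-- The inclusion of `C₀(ℝ, D)` in `C₀(ℝ, B)` induced by `i : D → B`. -/
def inclC₀ {𝕜 B D : Type*} [RCLike 𝕜] [NormedAddCommGroup B] [NormedSpace 𝕜 B]
    [NormedAddCommGroup D] [NormedSpace 𝕜 D] (i : D →L[𝕜] B) (f : C₀(ℝ, D)) : C₀(ℝ, B) where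
  toFun x := i (f x)
  continuous_toFun := i.continuous.comp f.continuous
  zero_at_infty' := by
    have h := (i.continuous.tendsto 0).comp (zero_at_infty f)
    rw [map_zero] at h
    exact h

/-- The generalized fractional derivative in generator form,
`D₊^(ν) f (x) = - ∫ (f (x - y) - f x) ν(dy)`. -/
def Dplus {B : Type*} [NormedAddCommGroup B] [NormedSpace ℝ B] (ν : Measure ℝ) (f : ℝ → B)
    (x : ℝ) : B :=
  -∫ y, (f (x - y) - f x) ∂ν

/-- The graph of the operator `L'_ν + A(·) = A(·) - D₊^(ν)` with the domain `C₀(ℝ, D)`, as an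
operator in `C₀(ℝ, B)`. -/
def operatorGraph {𝕜 B D : Type*} [RCLike 𝕜] [NormedAddCommGroup B] [NormedSpace 𝕜 B]
    [NormedSpace ℝ B] [NormedAddCommGroup D] [NormedSpace 𝕜 D]
    (i : D →L[𝕜] B) (A : ℝ → D →L[𝕜] B) (ν : Measure ℝ) : Set (C₀(ℝ, B) × C₀(ℝ, B)) :=
  {p | ∃ f : C₀(ℝ, D), p.1 = inclC₀ i f ∧ ∀ x, p.2 x = A x (f x) - Dplus ν (inclC₀ i f) x}

/-- `u` solves the Cauchy problem `∂ₜ uₜ(x) = A(x) uₜ(x) - D₊^(ν) uₜ(x)`, `u₀ = Y`, for `t ≥ 0`: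
it takes values in `C₀(ℝ, D)` and the time derivative (one-sided at `t = 0`) is taken in the norm
of `C₀(ℝ, B)`. -/
def IsSolution {𝕜 B D : Type*} [RCLike 𝕜] [NormedAddCommGroup B] [NormedSpace 𝕜 B]
    [NormedSpace ℝ B] [NormedAddCommGroup D] [NormedSpace 𝕜 D]
    (i : D →L[𝕜] B) (A : ℝ → D →L[𝕜] B) (ν : Measure ℝ) (Y : C₀(ℝ, D))
    (u : ℝ≥0 → C₀(ℝ, D)) : Prop :=
  u 0 = Y ∧ ∀ t : ℝ≥0, ∃ g : C₀(ℝ, B),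
    (∀ x, g x = A x (u t x) - Dplus ν (inclC₀ i (u t)) x) ∧
    HasDerivWithinAt (fun s : ℝ => inclC₀ i (u s.toNNReal)) g (Ici 0) t

/-- The open simplex `{0 < s₁ < ⋯ < sₙ < t}`. -/
def Sim (n : ℕ) (t : ℝ) : Set (Fin n → ℝ) :=
  {s | StrictMono s ∧ ∀ k, 0 < s k ∧ s k < t}

/-- Piecewise constant paths on `[0, t]` with finitely many jumps: a number `n` of jumps, jump
times in the simplex and jump sizes. -/
abbrev PC (t : ℝ) : Type := Σ n : ℕ, Sim n t × (Fin n → ℝ)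

namespace PC

variable {t : ℝ}

/-- The path `Z_x(τ) = x - ∑_{s_k ≤ τ} z_k` started at `x`. -/
def path (p : PC t) (x τ : ℝ) : ℝ :=
  x - ∑ k : Fin p.1, if p.2.1.1 k ≤ τ then p.2.2 k else 0

/-- Left ends `0, s₁, …, sₙ` of the intervals of constancy. -/
def left (p : PC t) : Fin (p.1 + 1) → ℝ := Fin.cons (α := fun _ => ℝ) 0 p.2.1.1

/-- Right ends `s₁, …, sₙ, t` of the intervals of constancy. -/
def right (p : PC t) : Fin (p.1 + 1) → ℝ := Fin.snoc (α := fun _ => ℝ) p.2.1.1 t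

/-- The backward chronological exponential `T exp {∫₀ᵗ A(Z_x(τ)) dτ}` along a piecewise constant
path, where `S y r = e^{r A(y)}`: the time-ordered product
`e^{s₁ A(x)} e^{(s₂ - s₁) A(Z_x(s₁))} ⋯ e^{(t - sₙ) A(Z_x(sₙ))}`. -/
def chronExp {𝕜 B : Type*} [RCLike 𝕜] [NormedAddCommGroup B] [NormedSpace 𝕜 B]
    (S : ℝ → ℝ≥0 → B →L[𝕜] B) (p : PC t) (x : ℝ) : B →L[𝕜] B :=
  (List.ofFn fun k : Fin (p.1 + 1) =>
    S (p.path x (p.left k)) (p.right k - p.left k).toNNReal).prod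

end PC

/-- The measure `ν^PC` on paths: on the paths with `n` jumps it is
`ds₁ ⋯ dsₙ ν(dz₁) ⋯ ν(dzₙ)`. -/
def pathMeasure (ν : Measure ℝ) (t : ℝ) : Measure (PC t) :=
  Measure.sum fun n : ℕ =>
    Measure.map (Sigma.mk n)
      ((Measure.comap Subtype.val volume : Measure (Sim n t)).prod (Measure.pi fun _ : Fin n => ν))

/-- The normalized path measure `e^{-t‖ν‖} ν^PC`; integration against it is `E_ν`. -/
def pathLaw (ν : Measure ℝ) (t : ℝ) : Measure (PC t) :=
  ENNReal.ofReal (Real.exp (-(t * ν.real univ))) • pathMeasure ν t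

end ChronPath

end

open ChronPath

noncomputable section

namespace ChronPath

/-! ### Strongly continuous semigroups, their generators and cores -/

section Semigroup

variable {𝕜 E F : Type*} [RCLike 𝕜] [NormedAddCommGroup E] [NormedSpace 𝕜 E]
  [NormedAddCommGroup F] [NormedSpace 𝕜 F]

/-! Since `ν` is finite, `-D₊^(ν)` is the bounded operator `N - ‖ν‖`, where `N` is convolution with
`ν`. The generator is therefore a bounded perturbation of multiplication by `A(·)`, whose semigroup
is explicit: `(M_t f)(x) = e^{tA(x)} f(x)`. That `M_t` preserves continuity in `x` follows from
Duhamel's formula `e^{tA(y)} d - e^{tA(x)} d = ∫₀ᵗ e^{(t-s)A(x)} (A(y) - A(x)) e^{sA(y)} d ds` for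
`d ∈ D`, by dominated convergence as `x → y` and density of `D`. Strong continuity in `t` holds
because orbits of elements of `D` are Lipschitz in time, uniformly in `x`.

The Dyson series of `M` perturbed by `N` solves a Volterra equation; uniqueness for that equation
gives the semigroup law, and the factor `e^{-t‖ν‖}` accounts for `-‖ν‖`. Evaluated at `x`, the
`n`-th term is an integral over `n` times in a simplex (from the iterated time integrals) and `n`
jump sizes (from the `n` factors `N`). It is the integral of the chronological exponential over the
paths with `n` jumps (`dyson_apply_eq_integral`), and summation over `n` gives the path integral.

The third space provides regularity. The same construction for the pair `Dt ⊂ D` gives a semigroup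
in `C₀(ℝ, D)`, and comparing Dyson series term by term shows that it is the restriction of the first
(`inclCLM_pathSemigroup`). So `C₀(ℝ, D)` is a dense invariant subspace of the domain, hence a core
(`generatorGraph_eq_closure_of_invariant`), and `Φ_t Y` stays in it and solves the Cauchy problem. A
solution `v` is unique because `r ↦ Φ_{t-r} v(r)` has zero right derivative
(`eq_apply_of_hasDerivWithinAt`). -/

/-- An `ε/3` argument: compare `T x f` and `T x₀ f₀` through one vector `f₁ ∈ s` near `f₀`; the
local bound on `‖T x‖` controls both replacements. -/
theorem continuous_uncurry_apply {X : Type*} [TopologicalSpace X] {T : X → E →L[𝕜] F} {s : Set E}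
    (hs : Dense s) (hb : ∀ x₀, ∃ C, ∀ᶠ x in 𝓝 x₀, ‖T x‖ ≤ C)
    (hc : ∀ f ∈ s, Continuous fun x => T x f) : Continuous fun p : X × E => T p.1 p.2 := by
  rw [continuous_iff_continuousAt]
  rintro ⟨x₀, f₀⟩
  rw [ContinuousAt, Metric.tendsto_nhds]
  intro ε hε
  obtain ⟨C₀, hC₀⟩ := hb x₀
  set C := max C₀ 0 + 1
  have hC : 0 < C := by positivity
  have hCb : ∀ᶠ x in 𝓝 x₀, ‖T x‖ ≤ C := hC₀.mono fun x hx =>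
    hx.trans ((le_max_left _ _).trans (le_add_of_nonneg_right zero_le_one))
  obtain ⟨f₁, hf₁, hd⟩ := hs.exists_dist_lt f₀ (ε := ε / (3 * C)) (by positivity)
  have h1 : ∀ᶠ x in 𝓝 x₀, dist (T x f₁) (T x₀ f₁) < ε / 3 :=
    Metric.tendsto_nhds.1 ((hc f₁ hf₁).tendsto x₀) _ (by positivity)
  have h2 : ∀ᶠ f in 𝓝 f₀, dist f f₁ < ε / (3 * C) :=
    Metric.isOpen_ball.mem_nhds (x := f₀) (s := Metric.ball f₁ (ε / (3 * C))) hd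
  rw [nhds_prod_eq]
  filter_upwards [(hCb.and h1).prod_mk h2] with p hp
  obtain ⟨⟨hp1, hp2⟩, hp3⟩ := hp
  have key : ∀ x f, ‖T x‖ ≤ C → dist f f₁ < ε / (3 * C) → dist (T x f) (T x f₁) < ε / 3 := by
    intro x f hx hf
    rw [dist_eq_norm, ← map_sub]
    calc ‖T x (f - f₁)‖ ≤ C * ‖f - f₁‖ := (T x).le_of_opNorm_le hx _
      _ < C * (ε / (3 * C)) := by rw [← dist_eq_norm]; gcongr
      _ = ε / 3 := by field_simp
  have h3 := key p.1 p.2 hp1 hp3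
  have h4 := key x₀ f₀ hCb.self_of_nhds hd
  rw [dist_comm] at h4
  calc dist (T p.1 p.2) (T x₀ f₀)
      ≤ dist (T p.1 p.2) (T p.1 f₁) + dist (T p.1 f₁) (T x₀ f₁) + dist (T x₀ f₁) (T x₀ f₀) :=
        dist_triangle4 _ _ _ _
    _ < ε := by linarith

/-- Orbits over the compact segment `[0, T]` are bounded, so the uniform boundedness principle
applies. -/
theorem IsC0Semigroup.exists_bound [CompleteSpace E] {S : ℝ≥0 → E →L[𝕜] E} (hS : IsC0Semigroup S)
    (T : ℝ≥0) : ∃ C : ℝ, 0 ≤ C ∧ ∀ t ≤ T, ‖S t‖ ≤ C := by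
  obtain ⟨C, hC⟩ := banach_steinhaus (g := fun t : Iic T => S t) fun f => by
    have hc : IsCompact (Iic T) := by
      rw [← Icc_bot]; exact isCompact_Icc
    obtain ⟨C, hC⟩ := (hc.image (hS.cont f)).isBounded.exists_norm_le
    exact ⟨C, fun t => hC _ ⟨t, t.2, rfl⟩⟩
  exact ⟨C, (norm_nonneg _).trans (hC ⟨0, mem_Iic.2 zero_le⟩), fun t ht => hC ⟨t, ht⟩⟩

theorem eventually_le_bound {S : ℝ≥0 → E →L[𝕜] E} (hS : ∀ T : ℝ≥0, ∃ C : ℝ, ∀ t ≤ T, ‖S t‖ ≤ C)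
    (t₀ : ℝ≥0) : ∃ C, ∀ᶠ t in 𝓝 t₀, ‖S t‖ ≤ C := by
  obtain ⟨C, hC⟩ := hS (t₀ + 1)
  exact ⟨C, (eventually_le_nhds (lt_add_one t₀)).mono fun t ht => hC t ht⟩

theorem IsC0Semigroup.continuous_uncurry [CompleteSpace E] {S : ℝ≥0 → E →L[𝕜] E}
    (hS : IsC0Semigroup S) : Continuous fun p : ℝ≥0 × E => S p.1 p.2 :=
  continuous_uncurry_apply dense_univ
    (eventually_le_bound fun T => (hS.exists_bound T).imp fun _ h => h.2) fun f _ => hS.cont f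

theorem IsC0Semigroup.continuous_real {S : ℝ≥0 → E →L[𝕜] E}
    (hS : IsC0Semigroup S) (f : E) : Continuous fun t : ℝ => S t.toNNReal f :=
  (hS.cont f).comp continuous_real_toNNReal

theorem IsC0Semigroup.add_apply {S : ℝ≥0 → E →L[𝕜] E} (hS : IsC0Semigroup S) (s t : ℝ≥0) (f : E) :
    S (s + t) f = S s (S t f) := by
  rw [hS.map_add]; rfl

theorem IsC0Semigroup.zero_apply {S : ℝ≥0 → E →L[𝕜] E} (hS : IsC0Semigroup S) (f : E) :
    S 0 f = f := by
  rw [hS.map_zero]; rfl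

theorem IsC0Semigroup.toNNReal_add_apply {S : ℝ≥0 → E →L[𝕜] E} (hS : IsC0Semigroup S) {s t : ℝ}
    (hs : 0 ≤ s) (ht : 0 ≤ t) (f : E) :
    S (s + t).toNNReal f = S s.toNNReal (S t.toNNReal f) := by
  rw [Real.toNNReal_add hs ht, hS.add_apply]

theorem map_mem_generatorGraph {S : ℝ≥0 → E →L[𝕜] E} (hS : IsC0Semigroup S) {f g : E}
    (h : (f, g) ∈ generatorGraph S) (t : ℝ≥0) : (S t f, S t g) ∈ generatorGraph S := by
  refine (((S t).continuous.tendsto g).comp h).congr fun s => ?_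
  simp only [Function.comp_apply, map_smul, map_sub]
  rw [← hS.add_apply, ← hS.add_apply, add_comm]

theorem continuous_apply_sub [CompleteSpace E] {S : ℝ≥0 → E →L[𝕜] E} (hS : IsC0Semigroup S)
    {v : ℝ → E} {K : Set ℝ} (hv : ContinuousOn v K) (t : ℝ) :
    ContinuousOn (fun r => S (t - r).toNNReal (v r)) K :=
  hS.continuous_uncurry.comp_continuousOn
    ((continuous_real_toNNReal.comp (continuous_const.sub continuous_id)).continuousOn.prodMk hv)

variable [NormedSpace ℝ E]

theorem tendsto_toNNReal_nhdsGT_zero : Tendsto Real.toNNReal (𝓝[>] 0) (𝓝[>] 0) := by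
  refine tendsto_nhdsWithin_iff.2 ⟨?_, ?_⟩
  · have := continuous_real_toNNReal.tendsto 0
    rw [Real.toNNReal_zero] at this
    exact this.mono_left nhdsWithin_le_nhds
  · exact eventually_mem_nhdsWithin.mono fun t ht => Real.toNNReal_pos.2 ht

theorem tendsto_coe_nhdsGT_zero : Tendsto ((↑) : ℝ≥0 → ℝ) (𝓝[>] 0) (𝓝[>] 0) := by
  refine tendsto_nhdsWithin_iff.2 ⟨?_, ?_⟩
  · exact (NNReal.continuous_coe.tendsto 0).mono_left nhdsWithin_le_nhds
  · exact eventually_mem_nhdsWithin.mono fun t ht => NNReal.coe_pos.2 ht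

theorem tendsto_sub_nhdsGT (s : ℝ) : Tendsto (fun r : ℝ => r - s) (𝓝[>] s) (𝓝[>] 0) := by
  refine tendsto_nhdsWithin_iff.2 ⟨?_, ?_⟩
  · have : Tendsto (fun r : ℝ => r - s) (𝓝 s) (𝓝 (s - s)) :=
      (continuous_id.sub continuous_const).tendsto s
    rw [sub_self] at this
    exact this.mono_left nhdsWithin_le_nhds
  · exact eventually_mem_nhdsWithin.mono fun r hr => mem_Ioi.2 (sub_pos.2 hr)

theorem mem_generatorGraph_iff_tendsto {S : ℝ≥0 → E →L[𝕜] E} {p : E × E} :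
    p ∈ generatorGraph S ↔
      Tendsto (fun t : ℝ => t⁻¹ • (S t.toNNReal p.1 - p.1)) (𝓝[>] 0) (𝓝 p.2) := by
  constructor
  · intro h
    refine (Tendsto.comp (g := fun t : ℝ≥0 => (((t : ℝ) : 𝕜))⁻¹ • (S t p.1 - p.1)) h
      tendsto_toNNReal_nhdsGT_zero).congr' ?_
    filter_upwards [eventually_mem_nhdsWithin] with t ht
    rw [RCLike.real_smul_eq_coe_smul (K := 𝕜), Function.comp_apply,
      Real.coe_toNNReal t (le_of_lt ht), RCLike.ofReal_inv]
  · intro h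
    refine (h.comp tendsto_coe_nhdsGT_zero).congr fun t => ?_
    rw [Function.comp_apply, RCLike.real_smul_eq_coe_smul (K := 𝕜), Real.toNNReal_coe,
      RCLike.ofReal_inv]

/-- For `s < r < t` the semigroup law turns the difference quotient into `S (t - r)` applied to the
quotient of `v` minus the quotient of `r ↦ S (r - s) (v s)`. Joint continuity of `S` passes to the
limit. -/
theorem hasDerivWithinAt_apply_sub [CompleteSpace E] {S : ℝ≥0 → E →L[𝕜] E} (hS : IsC0Semigroup S)
    {v : ℝ → E} {v' g : E} {s t : ℝ} (hst : s < t) (hg : (v s, g) ∈ generatorGraph S)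
    (hv : HasDerivWithinAt v v' (Ioi s) s) :
    HasDerivWithinAt (fun r => S (t - r).toNNReal (v r)) (S (t - s).toNNReal (v' - g))
      (Ioi s) s := by
  rw [hasDerivWithinAt_iff_tendsto_slope' self_notMem_Ioi] at hv ⊢
  have h1 : Tendsto (fun r : ℝ => (r - s)⁻¹ • (S (r - s).toNNReal (v s) - v s))
      (𝓝[>] s) (𝓝 g) := by
    exact (mem_generatorGraph_iff_tendsto.1 hg).comp (tendsto_sub_nhdsGT s)
  have h2 : Tendsto (fun r : ℝ => (t - r).toNNReal) (𝓝[>] s) (𝓝 (t - s).toNNReal) :=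
    ((continuous_real_toNNReal.comp (continuous_const.sub continuous_id)).tendsto s).mono_left
      nhdsWithin_le_nhds
  have h3 := (hS.continuous_uncurry.tendsto ((t - s).toNNReal, v' - g)).comp
    (h2.prodMk_nhds (hv.sub h1))
  refine h3.congr' ?_
  filter_upwards [Ioo_mem_nhdsGT hst] with r hr
  simp only [Function.comp_apply, slope_def_module]
  rw [show t - s = (t - r) + (r - s) by ring,
    hS.toNNReal_add_apply (sub_nonneg.2 hr.2.le) (sub_nonneg.2 hr.1.le), ← map_sub, ← smul_sub,
    ContinuousLinearMap.map_smul_of_tower]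
  congr 2
  abel

/-- If `v` solves `v' = G v`, with `G` the generator of `S`, then `v t = S t (v 0)`. -/
theorem eq_apply_of_hasDerivWithinAt [CompleteSpace E] {S : ℝ≥0 → E →L[𝕜] E}
    (hS : IsC0Semigroup S) {v v' : ℝ → E} {t : ℝ} (ht : 0 ≤ t) (hc : ContinuousOn v (Icc 0 t))
    (hv : ∀ s ∈ Ico 0 t, HasDerivWithinAt v (v' s) (Ioi s) s)
    (hg : ∀ s ∈ Ico 0 t, (v s, v' s) ∈ generatorGraph S) : v t = S t.toNNReal (v 0) := by
  have := constant_of_has_deriv_right_zero (f := fun r => S (t - r).toNNReal (v r)) (a := 0) (b := t)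
    (continuous_apply_sub hS hc t) (fun s hs => by
      have := hasDerivWithinAt_apply_sub hS hs.2 (hg s hs) (hv s hs)
      rw [sub_self, map_zero] at this
      exact hasDerivWithinAt_Ioi_iff_Ici.1 this) t ⟨ht, le_rfl⟩
  simpa [hS.zero_apply] using this

theorem hasDerivWithinAt_Ioi_apply {S : ℝ≥0 → E →L[𝕜] E} (hS : IsC0Semigroup S) {f g : E}
    (h : (f, g) ∈ generatorGraph S) {s : ℝ} (hs : 0 ≤ s) :
    HasDerivWithinAt (fun r : ℝ => S r.toNNReal f) (S s.toNNReal g) (Ioi s) s := by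
  rw [hasDerivWithinAt_iff_tendsto_slope' self_notMem_Ioi]
  have h1 := mem_generatorGraph_iff_tendsto.1 (map_mem_generatorGraph hS h s.toNNReal)
  refine (h1.comp (tendsto_sub_nhdsGT s)).congr' ?_
  filter_upwards [eventually_mem_nhdsWithin] with r hr
  simp only [Function.comp_apply, slope_def_module]
  rw [← hS.toNNReal_add_apply (sub_nonneg.2 (le_of_lt hr)) hs, sub_add_cancel]

theorem apply_sub_eq_integral [CompleteSpace E] {S : ℝ≥0 → E →L[𝕜] E} (hS : IsC0Semigroup S)
    {f g : E} (h : (f, g) ∈ generatorGraph S) {t : ℝ} (ht : 0 ≤ t) :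
    ∫ s in (0 : ℝ)..t, S s.toNNReal g = S t.toNNReal f - f := by
  have := intervalIntegral.integral_eq_sub_of_hasDeriv_right (a := 0) (b := t)
    (f := fun r : ℝ => S r.toNNReal f) (f' := fun s => S s.toNNReal g)
    (hS.continuous_real f).continuousOn (fun s hs => by
      rw [min_eq_left ht] at hs
      exact hasDerivWithinAt_Ioi_apply hS h hs.1.le)
    ((hS.continuous_real g).intervalIntegrable _ _)
  simpa [hS.zero_apply] using this

theorem tendsto_inv_smul_integral [CompleteSpace E] {w : ℝ → E} (hw : Continuous w) :
    Tendsto (fun t : ℝ => t⁻¹ • ∫ s in (0 : ℝ)..t, w s) (𝓝[>] 0) (𝓝 (w 0)) := by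
  have h := (hw.integral_hasStrictDerivAt 0 0).hasDerivAt.hasDerivWithinAt (s := Ioi 0)
  rw [hasDerivWithinAt_iff_tendsto_slope' self_notMem_Ioi] at h
  refine h.congr fun t => ?_
  simp [slope_def_module]

/-- Unlike the defining limit, the integrated form is a family of equations continuous in the pair.
It therefore yields closedness, and in `C₀` it can be checked point by point. -/
theorem mem_generatorGraph_iff [CompleteSpace E] {S : ℝ≥0 → E →L[𝕜] E} (hS : IsC0Semigroup S)
    {p : E × E} : p ∈ generatorGraph S ↔
      ∀ t : ℝ, 0 ≤ t → ∫ s in (0 : ℝ)..t, S s.toNNReal p.2 = S t.toNNReal p.1 - p.1 := by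
  refine ⟨fun h t ht => apply_sub_eq_integral hS h ht, fun h => ?_⟩
  rw [mem_generatorGraph_iff_tendsto]
  have := tendsto_inv_smul_integral (hS.continuous_real p.2)
  simp only [Real.toNNReal_zero, hS.zero_apply] at this
  refine this.congr' ?_
  filter_upwards [eventually_mem_nhdsWithin] with t ht
  rw [h t (le_of_lt ht)]

theorem hasDerivWithinAt_Ici_apply [CompleteSpace E] {S : ℝ≥0 → E →L[𝕜] E} (hS : IsC0Semigroup S)
    {f g : E} (h : (f, g) ∈ generatorGraph S) {t : ℝ} (ht : 0 ≤ t) :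
    HasDerivWithinAt (fun s : ℝ => S s.toNNReal f) (S t.toNNReal g) (Ici 0) t := by
  have h1 := (((hS.continuous_real g).integral_hasStrictDerivAt 0 t).hasDerivAt.hasDerivWithinAt
    (s := Ici 0)).const_add f
  refine h1.congr (fun s hs => ?_) ?_
  · rw [apply_sub_eq_integral hS h hs]; abel
  · rw [apply_sub_eq_integral hS h ht]; abel

theorem isClosed_generatorGraph [CompleteSpace E] {S : ℝ≥0 → E →L[𝕜] E} (hS : IsC0Semigroup S) :
    IsClosed (generatorGraph S) := by
  have : generatorGraph S = ⋂ t : ℝ, ⋂ _ : 0 ≤ t,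
      {p : E × E | ∫ s in (0 : ℝ)..t, S s.toNNReal p.2 = S t.toNNReal p.1 - p.1} := by
    ext p
    simp only [mem_iInter, mem_ofPred_eq, mem_generatorGraph_iff hS]
  rw [this]
  refine isClosed_iInter fun t => isClosed_iInter fun _ => isClosed_eq ?_ ?_
  · refine intervalIntegral.continuous_parametric_intervalIntegral_of_continuous' ?_ _ _
    exact hS.continuous_uncurry.comp
      ((continuous_real_toNNReal.comp continuous_snd).prodMk (continuous_snd.comp continuous_fst))
  · exact ((S t.toNNReal).continuous.comp continuous_fst).sub continuous_fst

/-- A strongly continuous semigroup is determined by its (densely defined) generator. -/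
theorem IsC0Semigroup.eq_of_generatorGraph_eq [CompleteSpace E] {S T : ℝ≥0 → E →L[𝕜] E}
    (hS : IsC0Semigroup S) (hT : IsC0Semigroup T) (h : generatorGraph S = generatorGraph T)
    {s : Set E} (hs : Dense s) (hd : ∀ f ∈ s, ∃ g, (f, g) ∈ generatorGraph S) : S = T := by
  funext t
  refine ContinuousLinearMap.ext fun f => ?_
  refine congrFun ((S t).continuous.ext_on hs (T t).continuous fun f hf => ?_) f
  obtain ⟨g, hg⟩ := hd f hf
  have := eq_apply_of_hasDerivWithinAt hT (v := fun r => S r.toNNReal f)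
    (v' := fun r => S r.toNNReal g) t.2 (hS.continuous_real f).continuousOn
    (fun r hr => hasDerivWithinAt_Ioi_apply hS hg hr.1)
    (fun r _ => h ▸ map_mem_generatorGraph hS hg _)
  simpa [hS.zero_apply] using this

/-- A dense invariant subspace contained in the domain of the generator is a core. -/
theorem generatorGraph_eq_closure_of_invariant [CompleteSpace E] {Φ : ℝ≥0 → E →L[𝕜] E}
    (hΦ : IsC0Semigroup Φ) {ι L : F →L[𝕜] E} {ΦF : ℝ≥0 → F →L[𝕜] F} (hd : DenseRange ι)
    (hint : ∀ t f, ι (ΦF t f) = Φ t (ι f)) (hL : ∀ f, (ι f, L f) ∈ generatorGraph Φ) :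
    generatorGraph Φ = closure (range fun f => (ι f, L f)) := by
  refine Subset.antisymm ?_ (closure_minimal (range_subset_iff.2 hL) (isClosed_generatorGraph hΦ))
  set G := closure (range fun f => (ι f, L f)) with hG
  have hGc : Convex ℝ G := by
    refine Convex.closure ?_
    rintro _ ⟨f, rfl⟩ _ ⟨g, rfl⟩ a b _ _ _
    refine ⟨((a : ℝ) : 𝕜) • f + ((b : ℝ) : 𝕜) • g, ?_⟩
    rw [RCLike.real_smul_eq_coe_smul (K := 𝕜) a, RCLike.real_smul_eq_coe_smul (K := 𝕜) b]
    simp only [map_add, map_smul, Prod.smul_mk, Prod.mk_add_mk]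
  -- Applying `Φ t` to the quotient of `ι f` gives the quotient of `ι (ΦF t f)`, so uniqueness of
  -- limits yields `Φ t (L f) = L (ΦF t f)`.
  have hΦG : ∀ f t, (Φ t (ι f), Φ t (L f)) ∈ G := by
    intro f t
    refine subset_closure ⟨ΦF t f, ?_⟩
    have h1 := map_mem_generatorGraph hΦ (hL f) t
    have h2 := hL (ΦF t f)
    rw [hint] at h2
    simp only [hint]
    exact congrArg _ (tendsto_nhds_unique h2 h1)
  -- time averages of orbits
  have havg : ∀ t : ℝ, 0 < t → ∀ f : E,
      (t⁻¹ • ∫ s in (0 : ℝ)..t, Φ s.toNNReal f, t⁻¹ • (Φ t.toNNReal f - f)) ∈ G := by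
    intro t ht
    have hcont : Continuous fun f : E =>
        (t⁻¹ • ∫ s in (0 : ℝ)..t, Φ s.toNNReal f, t⁻¹ • (Φ t.toNNReal f - f)) := by
      refine Continuous.prodMk (Continuous.const_smul ?_ _)
        ((((Φ t.toNNReal).continuous).sub continuous_id).const_smul _)
      refine intervalIntegral.continuous_parametric_intervalIntegral_of_continuous' ?_ _ _
      exact hΦ.continuous_uncurry.comp
        ((continuous_real_toNNReal.comp continuous_snd).prodMk continuous_fst)
    intro f
    -- The pair depends continuously on `f` and `G` is closed, so `f` may be taken in the dense
    -- range. There the pair is the mean over `(0, t]` of the points from `hΦG`, and a closed convex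
    -- set contains such means.
    refine hd.induction_on (p := fun f => (t⁻¹ • ∫ s in (0 : ℝ)..t, Φ s.toNNReal f,
      t⁻¹ • (Φ t.toNNReal f - f)) ∈ G) f (isClosed_closure.preimage hcont) fun f => ?_
    have hc : Continuous fun s : ℝ => (Φ s.toNNReal (ι f), Φ s.toNNReal (L f)) :=
      (hΦ.continuous_real _).prodMk (hΦ.continuous_real _)
    have hm := hGc.set_average_mem isClosed_closure (μ := volume) (t := Ioc 0 t)
      (f := fun s : ℝ => (Φ s.toNNReal (ι f), Φ s.toNNReal (L f)))
      (by simpa using ht) (by simp)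
      (Eventually.of_forall fun s => hΦG f _)
      ((hc.intervalIntegrable 0 t).1)
    rw [setAverage_eq, ← intervalIntegral.integral_of_le ht.le] at hm
    have hp : ∫ s in (0 : ℝ)..t, (Φ s.toNNReal (ι f), Φ s.toNNReal (L f))
        = (∫ s in (0 : ℝ)..t, Φ s.toNNReal (ι f), ∫ s in (0 : ℝ)..t, Φ s.toNNReal (L f)) := by
      rw [intervalIntegral.integral_of_le ht.le, intervalIntegral.integral_of_le ht.le,
        intervalIntegral.integral_of_le ht.le]
      exact integral_pair ((hΦ.continuous_real _).intervalIntegrable 0 t).1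
        ((hΦ.continuous_real _).intervalIntegrable 0 t).1
    rw [hp, apply_sub_eq_integral hΦ (hL f) ht.le] at hm
    simpa [ht.le] using hm
  rintro ⟨f, g⟩ hfg
  have h1 := tendsto_inv_smul_integral (hΦ.continuous_real f)
  simp only [Real.toNNReal_zero, hΦ.zero_apply] at h1
  -- As `t → 0+` the averaged pairs tend to `(f, g)`, whatever the element of the generator's graph.
  refine isClosed_closure.mem_of_tendsto
    (h1.prodMk_nhds (mem_generatorGraph_iff_tendsto.1 hfg)) ?_
  filter_upwards [eventually_mem_nhdsWithin] with t ht using havg t ht f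

end Semigroup

/-! ### Bounded perturbations by the Dyson series -/

section Perturbation

variable {𝕜 E F : Type*} [RCLike 𝕜] [NormedAddCommGroup E] [NormedSpace 𝕜 E] [NormedSpace ℝ E]
  [NormedAddCommGroup F] [NormedSpace 𝕜 F] [NormedSpace ℝ F]

/-- The terms of the Dyson series of the semigroup `M` perturbed by the bounded operator `N`. -/
def dyson (M : ℝ≥0 → E →L[𝕜] E) (N : E →L[𝕜] E) : ℕ → ℝ → E → E
  | 0, t, f => M t.toNNReal f
  | n + 1, t, f => ∫ r in (0 : ℝ)..t, M (t - r).toNNReal (N (dyson M N n r f))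

variable {M : ℝ≥0 → E →L[𝕜] E} {N : E →L[𝕜] E} [CompleteSpace E]

omit [NormedSpace ℝ E] in
theorem continuous_convolution (hM : IsC0Semigroup M) {w : ℝ → E} (hw : Continuous w) :
    Continuous fun p : ℝ × ℝ => M (p.1 - p.2).toNNReal (N (w p.2)) :=
  hM.continuous_uncurry.comp ((continuous_real_toNNReal.comp
    (continuous_fst.sub continuous_snd)).prodMk (N.continuous.comp (hw.comp continuous_snd)))

omit [NormedSpace ℝ E] in
theorem continuous_convolution_right (hM : IsC0Semigroup M) {w : ℝ → E} (hw : Continuous w)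
    (t : ℝ) : Continuous fun r : ℝ => M (t - r).toNNReal (N (w r)) :=
  (continuous_convolution hM hw).comp (continuous_const.prodMk continuous_id)

theorem continuous_dyson (hM : IsC0Semigroup M) (n : ℕ) (f : E) :
    Continuous fun t => dyson M N n t f := by
  induction n with
  | zero => exact hM.continuous_real f
  | succ n ih =>
    exact intervalIntegral.continuous_parametric_intervalIntegral_of_continuous
      (f := fun t r => M (t - r).toNNReal (N (dyson M N n r f)))
      (continuous_convolution hM ih) continuous_id

theorem dyson_add (hM : IsC0Semigroup M) (n : ℕ) (t : ℝ) (f g : E) :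
    dyson M N n t (f + g) = dyson M N n t f + dyson M N n t g := by
  induction n generalizing t with
  | zero => exact map_add _ _ _
  | succ n ih =>
    simp only [dyson, ih, map_add]
    exact intervalIntegral.integral_add
      ((continuous_convolution_right hM (continuous_dyson hM n f) t).intervalIntegrable _ _)
      ((continuous_convolution_right hM (continuous_dyson hM n g) t).intervalIntegrable _ _)

omit [CompleteSpace E] in
theorem dyson_smul (n : ℕ) (t : ℝ) (c : 𝕜) (f : E) :
    dyson M N n t (c • f) = c • dyson M N n t f := by
  induction n generalizing t with
  | zero => exact map_smul _ _ _
  | succ n ih =>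
    simp only [dyson, ih, map_smul]
    exact intervalIntegral.integral_smul _ _

omit [CompleteSpace E] in
-- There are `n + 1` factors `M` and `n` factors `N`; the iterated time integral contributes the
-- simplex volume `t ^ n / n!`.
theorem norm_dyson_le {C : ℝ} {T : ℝ≥0} (hC : 0 ≤ C)
    (hb : ∀ t ≤ T, ‖M t‖ ≤ C) (n : ℕ) {t : ℝ} (h0 : 0 ≤ t) (hT : t ≤ T) (f : E) :
    ‖dyson M N n t f‖ ≤ C * ‖f‖ * ((C * ‖N‖ * t) ^ n / n.factorial) := by
  induction n generalizing t with
  | zero =>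
    simpa [dyson] using (M t.toNNReal).le_of_opNorm_le (hb _ (Real.toNNReal_le_iff_le_coe.2 hT)) f
  | succ n ih =>
    have hle : ∀ r ∈ Ioc 0 t, ‖M (t - r).toNNReal (N (dyson M N n r f))‖ ≤
        C * ‖f‖ * ((C * ‖N‖) ^ (n + 1) / n.factorial) * r ^ n := by
      intro r hr
      calc ‖M (t - r).toNNReal (N (dyson M N n r f))‖
          ≤ C * ‖N (dyson M N n r f)‖ := (M _).le_of_opNorm_le
            (hb _ (Real.toNNReal_le_iff_le_coe.2 (by linarith [hr.1]))) _
        _ ≤ C * (‖N‖ * (C * ‖f‖ * ((C * ‖N‖ * r) ^ n / n.factorial))) := by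
            gcongr
            exact N.le_opNorm_of_le (ih hr.1.le (hr.2.trans hT))
        _ = _ := by rw [mul_pow _ r]; ring
    refine (intervalIntegral.norm_integral_le_of_norm_le h0 (Eventually.of_forall hle)
      (Continuous.intervalIntegrable (by fun_prop) _ _)).trans_eq ?_
    rw [intervalIntegral.integral_const_mul, integral_pow, Nat.factorial_succ]
    push_cast
    have : (n.factorial : ℝ) ≠ 0 := by positivity
    field_simp
    ring

theorem summable_dyson_bound (C K t a : ℝ) :
    Summable fun n : ℕ => a * ((C * K * t) ^ n / n.factorial) :=
  (Real.summable_pow_div_factorial _).mul_left _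

theorem summable_dyson (hM : IsC0Semigroup M) {t : ℝ} (ht : 0 ≤ t) (f : E) :
    Summable fun n => dyson M N n t f := by
  obtain ⟨C, hC, hb⟩ := hM.exists_bound t.toNNReal
  exact Summable.of_norm_bounded (summable_dyson_bound C ‖N‖ t (C * ‖f‖)) fun n =>
    norm_dyson_le hC hb n ht (Real.le_coe_toNNReal t) f

/-- The semigroup generated by `G + N`, where `G` is the generator of `M`. -/
def perturb (hM : IsC0Semigroup M) (N : E →L[𝕜] E) (t : ℝ≥0) : E →L[𝕜] E :=
  LinearMap.mkContinuousOfExistsBound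
    { toFun := fun f => ∑' n, dyson M N n t f
      map_add' := fun f g => by
        simp only [dyson_add hM]
        exact (summable_dyson hM t.coe_nonneg f).tsum_add (summable_dyson hM t.coe_nonneg g)
      map_smul' := fun c f => by
        simp only [dyson_smul, RingHom.id_apply]
        exact (summable_dyson hM t.coe_nonneg f).tsum_const_smul c }
    (by
      obtain ⟨C, hC, hb⟩ := hM.exists_bound t
      refine ⟨C * ∑' n : ℕ, (C * ‖N‖ * t) ^ n / n.factorial, fun f => ?_⟩
      have h := tsum_of_norm_bounded (summable_dyson_bound C ‖N‖ t (C * ‖f‖)).hasSum fun n =>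
        norm_dyson_le (N := N) hC hb n t.coe_nonneg le_rfl f
      rw [tsum_mul_left] at h
      refine h.trans_eq ?_
      ring)

theorem hasSum_perturb (hM : IsC0Semigroup M) {t : ℝ} (ht : 0 ≤ t) (f : E) :
    HasSum (fun n => dyson M N n t f) (perturb hM N t.toNNReal f) := by
  lift t to ℝ≥0 using ht
  rw [Real.toNNReal_coe]
  exact (summable_dyson hM t.coe_nonneg f).hasSum

theorem continuous_perturb (hM : IsC0Semigroup M) (f : E) :
    Continuous fun t => perturb hM N t f := by
  rw [continuous_iff_continuousAt]
  intro t₀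
  obtain ⟨C, hC, hb⟩ := hM.exists_bound (t₀ + 1)
  have : ContinuousOn (fun t : ℝ≥0 => ∑' n, dyson M N n t f) (Iic (t₀ + 1)) := by
    refine continuousOn_tsum (fun n => ((continuous_dyson hM n f).comp
      NNReal.continuous_coe).continuousOn)
      (summable_dyson_bound C ‖N‖ (t₀ + 1 : ℝ≥0) (C * ‖f‖)) fun n t ht => ?_
    have htT : (t : ℝ) ≤ (t₀ + 1 : ℝ≥0) := NNReal.coe_le_coe.2 ht
    refine (norm_dyson_le hC hb n t.coe_nonneg htT f).trans ?_
    gcongr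
  exact this.continuousAt (Iic_mem_nhds (lt_add_one t₀))

theorem continuous_perturb_real (hM : IsC0Semigroup M) (f : E) :
    Continuous fun t : ℝ => perturb hM N t.toNNReal f :=
  (continuous_perturb hM f).comp continuous_real_toNNReal

/-- Summing the recursion of the Dyson terms gives Duhamel's equation; sum and integral are
exchanged by dominated convergence, with the bounds of the terms taken at the endpoint `t`. -/
theorem perturb_eq (hM : IsC0Semigroup M) {t : ℝ} (ht : 0 ≤ t) (f : E) :
    perturb hM N t.toNNReal f = M t.toNNReal f +
      ∫ r in (0 : ℝ)..t, M (t - r).toNNReal (N (perturb hM N r.toNNReal f)) := by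
  obtain ⟨C, hC, hb⟩ := hM.exists_bound t.toNNReal
  have h : HasSum (fun n => dyson M N (n + 1) t f)
      (∫ r in (0 : ℝ)..t, M (t - r).toNNReal (N (perturb hM N r.toNNReal f))) := by
    refine intervalIntegral.hasSum_integral_of_dominated_convergence
      (fun n _ => C * (‖N‖ * (C * ‖f‖ * ((C * ‖N‖ * t) ^ n / n.factorial)))) (fun n => ?_)
      (fun n => ?_) ?_ ?_ ?_
    · exact (continuous_convolution_right hM (continuous_dyson hM n f) t).aestronglyMeasurable
    · refine Eventually.of_forall fun r hr => ?_
      rw [uIoc_of_le ht] at hr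
      have h1 : ‖dyson M N n r f‖ ≤ C * ‖f‖ * ((C * ‖N‖ * t) ^ n / n.factorial) := by
        refine (norm_dyson_le hC hb n hr.1.le
          (hr.2.trans (Real.le_coe_toNNReal t)) f).trans ?_
        have := hr.1.le
        have := hr.2
        gcongr
      exact ((M _).le_of_opNorm_le (hb _ (Real.toNNReal_le_toNNReal (by linarith [hr.1]))) _).trans
        (mul_le_mul_of_nonneg_left (N.le_opNorm_of_le h1) hC)
    · exact Eventually.of_forall fun r _ =>
        ((summable_dyson_bound C ‖N‖ t (C * ‖f‖)).mul_left _).mul_left _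
    · exact intervalIntegrable_const
    · refine Eventually.of_forall fun r hr => ?_
      rw [uIoc_of_le ht] at hr
      exact ((M (t - r).toNNReal).comp N).hasSum (hasSum_perturb hM hr.1.le f)
  refine (hasSum_perturb hM ht f).unique ?_
  rw [add_comm]
  exact (hasSum_nat_add_iff' 1).1 (by simpa [dyson] using h)

/-- Uniqueness of continuous solutions of the Volterra equation `u = M g + M * (N u)`. -/
theorem eq_of_volterra (hM : IsC0Semigroup M) {u v g : ℝ → E} (hu : Continuous u)
    (hv : Continuous v)
    (hu' : ∀ t, 0 ≤ t → u t = g t + ∫ r in (0 : ℝ)..t, M (t - r).toNNReal (N (u r)))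
    (hv' : ∀ t, 0 ≤ t → v t = g t + ∫ r in (0 : ℝ)..t, M (t - r).toNNReal (N (v r)))
    {t : ℝ} (ht : 0 ≤ t) : u t = v t := by
  obtain ⟨C, hC, hb⟩ := hM.exists_bound t.toNNReal
  set w : ℝ → E := fun r => u r - v r
  have hw : Continuous w := hu.sub hv
  have hle : ∀ s ∈ Icc 0 t, ‖w s‖ ≤ C * ‖N‖ * ∫ r in (0 : ℝ)..s, ‖w r‖ := by
    intro s hs
    have : w s = ∫ r in (0 : ℝ)..s, M (s - r).toNNReal (N (w r)) := by
      simp only [w, hu' s hs.1, hv' s hs.1, map_sub, add_sub_add_left_eq_sub]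
      exact (intervalIntegral.integral_sub
        ((continuous_convolution_right hM hu s).intervalIntegrable _ _)
        ((continuous_convolution_right hM hv s).intervalIntegrable _ _)).symm
    rw [this, ← intervalIntegral.integral_const_mul]
    refine intervalIntegral.norm_integral_le_of_norm_le hs.1 (Eventually.of_forall fun r hr => ?_)
      (Continuous.intervalIntegrable (by fun_prop) _ _)
    rw [mul_assoc]
    exact ((M _).le_of_opNorm_le
      (hb _ (Real.toNNReal_le_toNNReal (by linarith [hr.1, hs.2]))) _).trans (mul_le_mul_of_nonneg_left (N.le_opNorm _) hC)
  -- Grönwall for the primitive `s ↦ ∫₀ˢ ‖w‖`: it vanishes at `0`, and by `hle` its derivative is at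
  -- most `C * ‖N‖` times itself.
  have hz := eq_zero_of_abs_deriv_le_mul_abs_self_of_eq_zero_right
    (f := fun s => ∫ r in (0 : ℝ)..s, ‖w r‖) (f' := fun s => ‖w s‖) (K := C * ‖N‖) (a := 0) (b := t)
    (intervalIntegral.continuous_primitive
      (fun _ _ => hw.norm.intervalIntegrable _ _) _).continuousOn
    (fun s _ => (hw.norm.integral_hasStrictDerivAt 0 s).hasDerivAt.hasDerivWithinAt)
    intervalIntegral.integral_same (fun s hs => by
      have h0 : 0 ≤ ∫ r in (0 : ℝ)..s, ‖w r‖ :=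
        intervalIntegral.integral_nonneg hs.1 fun _ _ => norm_nonneg _
      rw [norm_norm, Real.norm_of_nonneg h0]
      exact hle s ⟨hs.1, hs.2.le⟩) t ⟨ht, le_rfl⟩
  have := hle t ⟨ht, le_rfl⟩
  rw [hz, mul_zero, norm_le_zero_iff] at this
  exact sub_eq_zero.1 this

/-- For the semigroup law, `r ↦ Φ (r + t) f` and `r ↦ Φ r (Φ t f)` solve the same Volterra equation
with free term `M r (Φ t f)`. For the former, the Duhamel integral over `[0, r + t]` is split at
`t`, and its first part is absorbed into the free term. -/
theorem isC0Semigroup_perturb (hM : IsC0Semigroup M) : IsC0Semigroup (perturb hM N) where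
  map_zero := by
    ext f
    have := perturb_eq (N := N) hM le_rfl f
    simpa [hM.zero_apply] using this
  map_add s t := by
    ext f
    have hΦ : ∀ f, Continuous fun t : ℝ => perturb hM N t.toNNReal f := continuous_perturb_real hM
    have hV : ∀ q : ℝ, 0 ≤ q → ∀ f, perturb hM N q.toNNReal f = M q.toNNReal f +
      ∫ r in (0 : ℝ)..q, M (q - r).toNNReal (N (perturb hM N r.toNNReal f)) :=
        fun q hq f => perturb_eq hM hq f
    generalize perturb hM N = Φ at hΦ hV ⊢
    have h := eq_of_volterra hM (N := N) (u := fun r => Φ (r + t).toNNReal f)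
      (v := fun r => Φ r.toNNReal (Φ t f)) (g := fun r => M r.toNNReal (Φ t f))
      ((hΦ f).comp (continuous_add_const _)) (hΦ _) (fun r hr => ?_)
      (fun r hr => hV r hr _) s.coe_nonneg
    · have h' : ((s : ℝ) + t).toNNReal = s + t := by
        rw [← NNReal.coe_add, Real.toNNReal_coe]
      simpa [h'] using h
    · have hc := continuous_convolution_right hM (N := N) (hΦ f) (r + t)
      have h2 := hV t t.coe_nonneg f
      rw [hV _ (add_nonneg hr t.coe_nonneg) f, ←
        intervalIntegral.integral_add_adjacent_intervals (b := (t : ℝ)) (hc.intervalIntegrable _ _) (hc.intervalIntegrable _ _), ← add_assoc]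
      congr 1
      · rw [Real.toNNReal_coe] at h2
        rw [h2, map_add, hM.toNNReal_add_apply hr t.coe_nonneg, Real.toNNReal_coe]
        congr 1
        · rw [← ContinuousLinearMap.intervalIntegral_comp_comm _
            ((continuous_convolution_right hM (hΦ f) _).intervalIntegrable _ _)]
          refine intervalIntegral.integral_congr fun q hq => ?_
          rw [uIcc_of_le t.coe_nonneg] at hq
          rw [← hM.toNNReal_add_apply hr (sub_nonneg.2 hq.2), add_sub_assoc]
      · have := intervalIntegral.integral_comp_add_right (a := 0) (b := r)
          (fun q => M (r + t - q).toNNReal (N (Φ q.toNNReal f))) (t : ℝ)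
        rw [zero_add] at this
        rw [← this]
        refine intervalIntegral.integral_congr fun q _ => ?_
        simp only [add_sub_add_right_eq_sub]
  cont := continuous_perturb hM

/-- Divide Duhamel's equation by `t`. Substituting `r = t * q` makes the mean of the integral term
an integral over `[0, 1]` of a jointly continuous function, which tends to `N f`. -/
theorem mem_generatorGraph_perturb (hM : IsC0Semigroup M) {f g : E}
    (h : (f, g) ∈ generatorGraph M) : (f, g + N f) ∈ generatorGraph (perturb hM N) := by
  rw [mem_generatorGraph_iff_tendsto] at h ⊢
  have hc : Continuous fun p : ℝ × ℝ =>
      M (p.1 - p.1 * p.2).toNNReal (N (perturb hM N (p.1 * p.2).toNNReal f)) :=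
    hM.continuous_uncurry.comp ((continuous_real_toNNReal.comp (by fun_prop)).prodMk
      (N.continuous.comp ((continuous_perturb_real hM f).comp (by fun_prop))))
  have h1 := (intervalIntegral.continuous_parametric_intervalIntegral_of_continuous'
    (f := fun t q => M (t - t * q).toNNReal (N (perturb hM N (t * q).toNNReal f)))
    (μ := volume) hc 0 1).tendsto 0
  have hzero : perturb hM N 0 f = f := (isC0Semigroup_perturb hM).zero_apply f
  simp only [zero_mul, sub_zero, Real.toNNReal_zero, hM.zero_apply, hzero,
    intervalIntegral.integral_const, one_smul] at h1
  refine (h.add (h1.mono_left nhdsWithin_le_nhds)).congr' ?_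
  filter_upwards [eventually_mem_nhdsWithin] with t ht
  have ht0 : (0 : ℝ) < t := ht
  have hs := intervalIntegral.smul_integral_comp_mul_left (a := 0) (b := 1)
    (fun r => M (t - r).toNNReal (N (perturb hM N r.toNNReal f))) t
  rw [mul_zero, mul_one] at hs
  rw [perturb_eq hM ht0.le f, ← hs, add_sub_right_comm, smul_add, smul_smul,
    inv_mul_cancel₀ ht0.ne', one_smul]

/-- The intertwining passes through each Dyson term by induction, then to the sum by continuity of
`ι`. -/
theorem perturb_intertwine [CompleteSpace F] {M' : ℝ≥0 → F →L[𝕜] F} {N' : F →L[𝕜] F}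
    (hM : IsC0Semigroup M) (hM' : IsC0Semigroup M') {ι : F →L[𝕜] E}
    (h : ∀ t f, ι (M' t f) = M t (ι f)) (hN : ∀ f, ι (N' f) = N (ι f)) (t : ℝ≥0) (f : F) :
    ι (perturb hM' N' t f) = perturb hM N t (ι f) := by
  have hd : ∀ n t, ι (dyson M' N' n t f) = dyson M N n t (ι f) := by
    intro n
    induction n with
    | zero => exact fun t => h _ f
    | succ n ih =>
      intro t
      simp only [dyson]
      rw [← ContinuousLinearMap.intervalIntegral_comp_comm _
        ((continuous_convolution_right hM' (continuous_dyson hM' n f) t).intervalIntegrable _ _)]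
      simp only [h, hN, ih]
  have h1 := (hasSum_perturb (N := N') hM' t.coe_nonneg f).mapL ι
  have h2 := hasSum_perturb (N := N) hM t.coe_nonneg (ι f)
  simp only [hd] at h1
  have := h1.unique h2
  change ι (perturb hM' N' (t : ℝ).toNNReal f) = perturb hM N (t : ℝ).toNNReal (ι f) at this
  rwa [Real.toNNReal_coe] at this

/-- The semigroup generated by `G - c`, where `G` is the generator of `M`. -/
def expScale (c : ℝ) (M : ℝ≥0 → E →L[𝕜] E) (t : ℝ≥0) : E →L[𝕜] E :=
  ((Real.exp (-(c * t)) : ℝ) : 𝕜) • M t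

omit [CompleteSpace E] in
theorem expScale_apply (c : ℝ) (t : ℝ≥0) (f : E) :
    expScale c M t f = Real.exp (-(c * t)) • M t f := by
  rw [RCLike.real_smul_eq_coe_smul (K := 𝕜)]; rfl

omit [CompleteSpace E] in
theorem isC0Semigroup_expScale (c : ℝ) (hM : IsC0Semigroup M) :
    IsC0Semigroup (expScale c M) where
  map_zero := by ext f; simp [expScale_apply, hM.zero_apply]
  map_add s t := by
    ext f
    rw [mul_apply_eq_comp, expScale_apply, expScale_apply, expScale_apply,
      ContinuousLinearMap.map_smul_of_tower, smul_smul, hM.add_apply, ← Real.exp_add]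
    congr 2
    push_cast; ring
  cont f := by
    simp only [expScale_apply]
    exact Continuous.smul (by fun_prop) (hM.cont f)

omit [CompleteSpace E] in
theorem mem_generatorGraph_expScale (c : ℝ) (hM : IsC0Semigroup M) {f g : E}
    (h : (f, g) ∈ generatorGraph M) : (f, g - c • f) ∈ generatorGraph (expScale c M) := by
  rw [mem_generatorGraph_iff_tendsto]
  have h1 := hasDerivWithinAt_Ioi_apply hM h le_rfl
  have h2 : HasDerivAt (fun t : ℝ => Real.exp (-(c * t))) (-c) 0 := by
    have := (((hasDerivAt_id (0 : ℝ)).const_mul c).neg).exp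
    simpa using this
  have h3 := h2.hasDerivWithinAt (s := Ioi 0) |>.smul h1
  rw [hasDerivWithinAt_iff_tendsto_slope' self_notMem_Ioi] at h3
  have h4 : Real.exp (-(c * 0)) • M (0 : ℝ).toNNReal g + (-c) • M (0 : ℝ).toNNReal f
      = g - c • f := by
    simp [hM.zero_apply, sub_eq_add_neg]
  rw [h4] at h3
  refine h3.congr' ?_
  filter_upwards [eventually_mem_nhdsWithin] with t ht
  simp only [slope_def_module, expScale_apply, Real.coe_toNNReal t (le_of_lt ht)]
  simp [hM.zero_apply]

end Perturbation

/-! ### Operators on functions vanishing at infinity -/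

section ZeroAtInfty

variable {𝕜 E F : Type*} [RCLike 𝕜] [NormedAddCommGroup E] [NormedSpace 𝕜 E]
  [NormedAddCommGroup F] [NormedSpace 𝕜 F]

theorem norm_apply_le (f : C₀(ℝ, E)) (x : ℝ) : ‖f x‖ ≤ ‖f‖ := by
  rw [← ZeroAtInftyContinuousMap.norm_toBCF_eq_norm]
  exact f.toBCF.norm_coe_le_norm x

theorem norm_le_of_apply_le {f : C₀(ℝ, E)} {C : ℝ} (hC : 0 ≤ C) (h : ∀ x, ‖f x‖ ≤ C) :
    ‖f‖ ≤ C := by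
  rw [← ZeroAtInftyContinuousMap.norm_toBCF_eq_norm]
  exact (BoundedContinuousFunction.norm_le hC).2 h

/-- Evaluation at a point as a bounded operator. -/
def evalC₀ (𝕜 : Type*) {E : Type*} [RCLike 𝕜] [NormedAddCommGroup E] [NormedSpace 𝕜 E] (x : ℝ) :
    C₀(ℝ, E) →L[𝕜] E :=
  LinearMap.mkContinuous
    { toFun := fun f => f x
      map_add' := fun _ _ => rfl
      map_smul' := fun _ _ => rfl } 1 fun f => by
        rw [one_mul]; exact norm_apply_le f x

@[simp]
theorem evalC₀_apply (x : ℝ) (f : C₀(ℝ, E)) : evalC₀ 𝕜 x f = f x := rfl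

theorem UnifBoundedStronglyCont.continuous_uncurry {T : ℝ → E →L[𝕜] F}
    (hT : UnifBoundedStronglyCont T) : Continuous fun p : ℝ × E => T p.1 p.2 :=
  continuous_uncurry_apply dense_univ
    (fun _ => hT.1.imp fun _ h => Eventually.of_forall h) fun f _ => hT.2 f

theorem UnifBoundedStronglyCont.exists_bound {T : ℝ → E →L[𝕜] F}
    (hT : UnifBoundedStronglyCont T) : ∃ C : ℝ, 0 ≤ C ∧ ∀ x, ‖T x‖ ≤ C :=
  hT.1.imp fun _ h => ⟨(norm_nonneg _).trans (h 0), h⟩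

/-- The operator `(T f) x = T x (f x)`. -/
def mulC₀ (T : ℝ → E →L[𝕜] F) (hT : UnifBoundedStronglyCont T) : C₀(ℝ, E) →L[𝕜] C₀(ℝ, F) :=
  LinearMap.mkContinuousOfExistsBound
    { toFun := fun f =>
        { toFun := fun x => T x (f x)
          continuous_toFun := hT.continuous_uncurry.comp (continuous_id.prodMk f.continuous)
          zero_at_infty' := by
            obtain ⟨C, hC⟩ := hT.1
            have h := (zero_at_infty f).norm.const_mul C
            rw [norm_zero, mul_zero] at h
            exact squeeze_zero_norm (fun x => (T x).le_of_opNorm_le (hC x) _) h }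
      map_add' := fun f g => ZeroAtInftyContinuousMap.ext fun x => map_add (T x) (f x) (g x)
      map_smul' := fun c f => ZeroAtInftyContinuousMap.ext fun x => map_smul (T x) c (f x) }
    (by
      obtain ⟨C, hC, hb⟩ := hT.exists_bound
      exact ⟨C, fun f => norm_le_of_apply_le (by positivity) fun x =>
        (T x).le_of_opNorm_le_of_le (hb x) (norm_apply_le f x)⟩)

theorem norm_mulC₀_le (T : ℝ → E →L[𝕜] F) (hT : UnifBoundedStronglyCont T) {C : ℝ} (hC : 0 ≤ C)
    (hb : ∀ x, ‖T x‖ ≤ C) : ‖mulC₀ T hT‖ ≤ C :=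
  ContinuousLinearMap.opNorm_le_bound _ hC fun f =>
    norm_le_of_apply_le (by positivity) fun x =>
      (T x).le_of_opNorm_le_of_le (hb x) (norm_apply_le f x)

theorem unifBoundedStronglyCont_const (k : E →L[𝕜] F) :
    UnifBoundedStronglyCont fun _ : ℝ => k :=
  ⟨⟨‖k‖, fun _ => le_rfl⟩, fun _ => continuous_const⟩

/-- The operator `C₀(ℝ, E) → C₀(ℝ, F)` induced by `k : E → F`. -/
def inclCLM (k : E →L[𝕜] F) : C₀(ℝ, E) →L[𝕜] C₀(ℝ, F) :=
  mulC₀ (fun _ => k) (unifBoundedStronglyCont_const k)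

/-- Approximate locally by constants and glue with a partition of unity, since the pointwise
constraints are convex. Closeness in `F` does not control the norm in `E`, so vanishing at infinity
is forced by requiring `d = 0` wherever `f` is small. -/
theorem denseRange_inclCLM [NormedSpace ℝ E] [NormedSpace ℝ F] {k : E →L[𝕜] F}
    (hk : DenseRange k) : DenseRange (inclCLM k) := by
  refine Metric.denseRange_iff.2 fun f ε hε => ?_
  obtain ⟨g, hg⟩ := exists_continuous_forall_mem_convex_of_local
    (t := fun x => {d : E | ‖k d - f x‖ < ε / 2 ∧ (‖f x‖ < ε / 4 → d = 0)})
    (fun x => by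
      rintro d ⟨hd, hd0⟩ e ⟨he, he0⟩ a b ha hb hab
      refine ⟨?_, fun h => by simp [hd0 h, he0 h]⟩
      have hc := convex_ball (f x) (ε / 2) (x := k d) (by simpa [dist_eq_norm] using hd)
        (y := k e) (by simpa [dist_eq_norm] using he) ha hb hab
      rw [map_add, ContinuousLinearMap.map_smul_of_tower, ContinuousLinearMap.map_smul_of_tower]
      simpa [dist_eq_norm] using hc)
    (fun x => by
      -- The thresholds overlap: where `‖f‖ < ε / 2` the section `0` is close enough, and where `‖f‖
      -- > ε / 4` the requirement `d = 0` is void.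
      by_cases hx : ‖f x‖ < ε / 2
      · refine ⟨{y | ‖f y‖ < ε / 2}, (isOpen_lt f.continuous.norm continuous_const).mem_nhds hx,
          fun _ => 0, continuousOn_const, fun y hy => ⟨?_, fun _ => rfl⟩⟩
        rw [map_zero, zero_sub, norm_neg]
        exact hy
      · obtain ⟨d, hd⟩ := hk.exists_dist_lt (f x) (half_pos hε)
        have ho : IsOpen ({y | ‖k d - f y‖ < ε / 2} ∩ {y | ε / 4 < ‖f y‖}) :=
          (isOpen_lt (continuous_const.sub f.continuous).norm continuous_const).inter
            (isOpen_lt continuous_const f.continuous.norm)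
        refine ⟨_, ho.mem_nhds ⟨?_, ?_⟩, fun _ => d, continuousOn_const,
          fun y hy => ⟨hy.1, fun h => absurd h hy.2.not_gt⟩⟩
        · rw [dist_comm, dist_eq_norm] at hd
          exact hd
        · have : ε / 2 ≤ ‖f x‖ := not_lt.1 hx
          exact lt_of_lt_of_le (by linarith) this)
  have hsmall : ∀ᶠ x in cocompact ℝ, ‖f x‖ < ε / 4 := by
    have := (zero_at_infty f).norm
    rw [norm_zero] at this
    exact this.eventually (gt_mem_nhds (by positivity))
  refine ⟨⟨g, ?_⟩, ?_⟩
  · refine tendsto_const_nhds.congr' ?_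
    filter_upwards [hsmall] with x hx using ((hg x).2 hx).symm
  · rw [dist_comm, dist_eq_norm]
    refine lt_of_le_of_lt (norm_le_of_apply_le (half_pos hε).le fun x => ?_) (half_lt_self hε)
    exact (hg x).1.le

theorem integrable_apply_sub (ν : Measure ℝ) [IsFiniteMeasure ν] (f : C₀(ℝ, E)) (x : ℝ) :
    Integrable (fun y => f (x - y)) ν :=
  Integrable.of_bound (f.continuous.comp (continuous_const.sub continuous_id)).aestronglyMeasurable
    ‖f‖ (Eventually.of_forall fun _ => norm_apply_le f _)

/-- The convolution `x ↦ ∫ f (x - y) ν(dy)` as a bounded operator. -/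
def convC₀ (𝕜 : Type*) {E : Type*} [RCLike 𝕜] [NormedAddCommGroup E] [NormedSpace 𝕜 E]
    [NormedSpace ℝ E] (ν : Measure ℝ) [IsFiniteMeasure ν] : C₀(ℝ, E) →L[𝕜] C₀(ℝ, E) :=
  LinearMap.mkContinuous
    { toFun := fun f =>
        { toFun := fun x => ∫ y, f (x - y) ∂ν
          continuous_toFun := continuous_of_dominated
            (fun x => (integrable_apply_sub ν f x).aestronglyMeasurable)
            (fun x => Eventually.of_forall fun y => norm_apply_le f _)
            (integrable_const ‖f‖)
            (Eventually.of_forall fun y => f.continuous.comp (continuous_sub_right y))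
          zero_at_infty' := by
            -- Dominated convergence along a filter needs it countably generated.
            have : (cocompact ℝ).IsCountablyGenerated := by
              rw [cocompact_eq_atBot_atTop]; infer_instance
            have h := tendsto_integral_filter_of_dominated_convergence (l := cocompact ℝ) (μ := ν)
              (F := fun x y => f (x - y)) (f := fun _ => (0 : E)) (fun _ => ‖f‖)
              (Eventually.of_forall fun x => (integrable_apply_sub ν f x).aestronglyMeasurable)
              (Eventually.of_forall fun x => Eventually.of_forall fun y => norm_apply_le f _)
              (integrable_const ‖f‖)
              (Eventually.of_forall fun y => (zero_at_infty f).comp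
                (Homeomorph.subRight y).isClosedEmbedding.tendsto_cocompact)
            rwa [integral_zero] at h }
      map_add' := fun f g => ZeroAtInftyContinuousMap.ext fun x =>
        integral_add (integrable_apply_sub ν f x) (integrable_apply_sub ν g x)
      map_smul' := fun c f => ZeroAtInftyContinuousMap.ext fun x => integral_smul c _ }
    (ν.real univ) fun f => norm_le_of_apply_le (by positivity) fun x => by
      have := norm_integral_le_of_norm_le_const (μ := ν) (f := fun y => f (x - y)) (C := ‖f‖)
        (Eventually.of_forall fun _ => norm_apply_le f _)
      rwa [mul_comm] at this

@[simp]
theorem convC₀_apply [NormedSpace ℝ E] (ν : Measure ℝ) [IsFiniteMeasure ν] (f : C₀(ℝ, E)) (x : ℝ) :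
    convC₀ 𝕜 ν f x = ∫ y, f (x - y) ∂ν := rfl

theorem inclCLM_convC₀ [NormedSpace ℝ E] [CompleteSpace E] [NormedSpace ℝ F] [CompleteSpace F]
    (k : E →L[𝕜] F) (ν : Measure ℝ) [IsFiniteMeasure ν] (f : C₀(ℝ, E)) :
    inclCLM k (convC₀ 𝕜 ν f) = convC₀ 𝕜 ν (inclCLM k f) :=
  ZeroAtInftyContinuousMap.ext fun x =>
    (k.integral_comp_comm (integrable_apply_sub ν f x)).symm

/-- This splits the jump operator into the bounded perturbation entering the Dyson series and a
scalar that only rescales by an exponential. -/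
theorem neg_Dplus_apply [NormedSpace ℝ E] [CompleteSpace E] (ν : Measure ℝ) [IsFiniteMeasure ν]
    (f : C₀(ℝ, E)) (x : ℝ) :
    -Dplus ν f x = convC₀ 𝕜 ν f x - ν.real univ • f x := by
  rw [Dplus, neg_neg, integral_sub (integrable_apply_sub ν f x) (integrable_const _),
    integral_const, convC₀_apply]

end ZeroAtInfty

/-! ### Continuity in the parameter and the multiplication semigroup -/

section Family

variable {𝕜 E F : Type*} [RCLike 𝕜] [NormedAddCommGroup E] [NormedSpace 𝕜 E]
  [NormedAddCommGroup F] [NormedSpace 𝕜 F]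

/-- A uniformly bounded family of semigroups `S x` in `E` with generators extending the bounded
operators `A x : F → E`, and leaving invariant the dense subspace `F` of `E`. -/
structure IsRegularFamily (k : F →L[𝕜] E) (A : ℝ → F →L[𝕜] E) (S : ℝ → ℝ≥0 → E →L[𝕜] E)
    (S' : ℝ → ℝ≥0 → F →L[𝕜] F) : Prop where
  dense : DenseRange k
  bdd_A : UnifBoundedStronglyCont A
  semigroup : ∀ x, IsC0Semigroup (S x)
  bdd : UnifBounded S
  gen : ∀ x d, (k d, A x d) ∈ generatorGraph (S x)
  restrict : ∀ x t d, k (S' x t d) = S x t (k d)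
  bdd' : UnifBounded S'

theorem UnifBounded.exists_bound {S : ℝ → ℝ≥0 → E →L[𝕜] E} (hS : UnifBounded S) (T : ℝ≥0) :
    ∃ C : ℝ, 0 ≤ C ∧ ∀ x, ∀ t ≤ T, ‖S x t‖ ≤ C :=
  (hS T).imp fun _ h => ⟨(norm_nonneg _).trans (h 0 0 zero_le), h⟩

namespace IsRegularFamily

variable [NormedSpace ℝ E] [CompleteSpace E] {k : F →L[𝕜] E} {A : ℝ → F →L[𝕜] E}
  {S : ℝ → ℝ≥0 → E →L[𝕜] E} {S' : ℝ → ℝ≥0 → F →L[𝕜] F}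

omit [NormedSpace ℝ E] [CompleteSpace E] in
theorem apply_A (h : IsRegularFamily k A S S') (x : ℝ) (t : ℝ≥0) (d : F) :
    S x t (A x d) = A x (S' x t d) := by
  have h1 := map_mem_generatorGraph (h.semigroup x) (h.gen x d) t
  have h2 := h.gen x (S' x t d)
  rw [h.restrict] at h2
  exact tendsto_nhds_unique h1 h2

omit [CompleteSpace E] in
-- `IsRegularFamily` does not provide continuity of `S'` in time. The function is instead a
-- pointwise limit of difference quotients of `S x` along the continuous orbit `S y s (k d)`.
theorem measurable_apply (h : IsRegularFamily k A S S') (x y : ℝ) (d : F) :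
    StronglyMeasurable fun s : ℝ => A x (S' y s.toNNReal d) := by
  have hu : Tendsto (fun n : ℕ => (1 : ℝ) / ((n : ℝ) + 1)) atTop (𝓝[>] 0) :=
    tendsto_nhdsWithin_iff.2 ⟨tendsto_one_div_add_atTop_nhds_zero_nat,
      Eventually.of_forall fun n => mem_Ioi.2 Nat.one_div_pos_of_nat⟩
  refine stronglyMeasurable_of_tendsto atTop (f := fun (n : ℕ) (s : ℝ) =>
    (1 / ((n : ℝ) + 1))⁻¹ • (S x (1 / ((n : ℝ) + 1)).toNNReal (S y s.toNNReal (k d)) -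
      S y s.toNNReal (k d))) (fun n => ?_) (tendsto_pi_nhds.2 fun s => ?_)
  · have hc := (h.semigroup y).continuous_real (k d)
    exact ((((S x _).continuous.comp hc).sub hc).const_smul _).stronglyMeasurable
  · have := h.gen x (S' y s.toNNReal d)
    rw [h.restrict] at this
    exact (mem_generatorGraph_iff_tendsto.1 this).comp hu

/-- Duhamel's estimate for the dependence of the semigroups on the parameter. -/
theorem norm_apply_sub_le (h : IsRegularFamily k A S S') {C : ℝ} {T : ℝ≥0}
    (hb : ∀ x, ∀ t ≤ T, ‖S x t‖ ≤ C) (x y : ℝ) (d : F) {t : ℝ≥0} (ht : t ≤ T) :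
    ‖S y t (k d) - S x t (k d)‖ ≤
      ∫ s in (0 : ℝ)..T, C * ‖A y (S' y s.toNNReal d) - A x (S' y s.toNNReal d)‖ := by
  have hC : 0 ≤ C := (norm_nonneg _).trans (hb 0 0 zero_le)
  obtain ⟨CA, hCA, hbA⟩ := h.bdd_A.exists_bound
  obtain ⟨C', hC', hb'⟩ := h.bdd'.exists_bound T
  have hAb : ∀ z, ∀ s : ℝ, s ≤ T → ‖A z (S' y s.toNNReal d)‖ ≤ CA * (C' * ‖d‖) := fun z s hs =>
    (A z).le_of_opNorm_le_of_le (hbA z)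
      ((S' y _).le_of_opNorm_le (hb' y _ (Real.toNNReal_le_iff_le_coe.2 hs)) d)
  set b : ℝ → E := fun s => A y (S' y s.toNNReal d) - A x (S' y s.toNNReal d) with hbdef
  have hbm : StronglyMeasurable b := (h.measurable_apply y y d).sub (h.measurable_apply x y d)
  have hbb : ∀ s : ℝ, s ≤ T → ‖b s‖ ≤ CA * (C' * ‖d‖) + CA * (C' * ‖d‖) := fun s hs =>
    (norm_sub_le _ _).trans (add_le_add (hAb y s hs) (hAb x s hs))
  have hbi : IntervalIntegrable (fun s => C * ‖b s‖) volume 0 T := by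
    rw [intervalIntegrable_iff_integrableOn_Ioc_of_le T.coe_nonneg]
    refine IntegrableOn.of_bound (by simp) (hbm.norm.const_mul C).aestronglyMeasurable
      (C * (CA * (C' * ‖d‖) + CA * (C' * ‖d‖))) ?_
    refine (ae_restrict_iff' measurableSet_Ioc).2 (Eventually.of_forall fun s hs => ?_)
    rw [Real.norm_of_nonneg (by positivity)]
    exact mul_le_mul_of_nonneg_left (hbb s hs.2) hC
  have htT : (t : ℝ) ≤ T := NNReal.coe_le_coe.2 ht
  have hle : ∀ s ∈ Ioc (0 : ℝ) t, ‖S x (t - s).toNNReal (b s)‖ ≤ C * ‖b s‖ := fun s hs =>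
    (S x _).le_of_opNorm_le (hb x _ (Real.toNNReal_le_iff_le_coe.2 (by linarith [hs.1]))) _
  have hbi' : IntervalIntegrable (fun s => C * ‖b s‖) volume 0 t :=
    hbi.mono_set (by
      rw [uIcc_of_le t.coe_nonneg, uIcc_of_le T.coe_nonneg]
      exact Icc_subset_Icc_right htT)
  have hm : StronglyMeasurable fun s : ℝ => S x (t - s).toNNReal (b s) :=
    (h.semigroup x).continuous_uncurry.comp_stronglyMeasurable
      (g := fun p : ℝ≥0 × E => S x p.1 p.2) (f := fun s : ℝ => ((t - s).toNNReal, b s))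
      ((continuous_real_toNNReal.comp
        (continuous_const.sub continuous_id)).stronglyMeasurable.prodMk hbm)
  -- The interpolation `s ↦ S x (t - s) (S y s (k d))` joins `S x t (k d)` to `S y t (k d)` and has
  -- right derivative `S x (t - s) (b s)`.
  have hint := intervalIntegral.integral_eq_sub_of_hasDeriv_right (a := 0) (b := (t : ℝ))
    (f := fun s : ℝ => S x (t - s).toNNReal (S y s.toNNReal (k d)))
    (f' := fun s : ℝ => S x (t - s).toNNReal (b s))
    (continuous_apply_sub (h.semigroup x) ((h.semigroup y).continuous_real _).continuousOn _)
    (fun s hs => by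
      rw [min_eq_left t.coe_nonneg, max_eq_right t.coe_nonneg] at hs
      have h1 := hasDerivWithinAt_Ioi_apply (h.semigroup y) (h.gen y d) hs.1.le
      rw [h.apply_A] at h1
      have h2 := h.gen x (S' y s.toNNReal d)
      rw [h.restrict] at h2
      exact hasDerivWithinAt_apply_sub (h.semigroup x) hs.2 h2 h1)
    (by
      refine hbi'.mono_fun hm.aestronglyMeasurable ?_
      rw [uIoc_of_le t.coe_nonneg]
      refine (ae_restrict_iff' measurableSet_Ioc).2 (Eventually.of_forall fun s hs => ?_)
      exact (hle s hs).trans (le_abs_self _))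
  have h0 : S y t (k d) - S x t (k d) =
      ∫ s in (0 : ℝ)..t, S x (t - s).toNNReal (b s) := by
    rw [hint]
    simp [(h.semigroup x).zero_apply, (h.semigroup y).zero_apply]
  rw [h0]
  refine (intervalIntegral.norm_integral_le_of_norm_le t.coe_nonneg
    (Eventually.of_forall hle) hbi').trans ?_
  -- Enlarging the interval to `[0, T]` makes the bound independent of `t`.
  exact intervalIntegral.integral_mono_interval le_rfl t.coe_nonneg htT
    (Eventually.of_forall fun s => mul_nonneg hC (norm_nonneg _)) hbi

omit [CompleteSpace E] in
-- The orbit belongs to the fixed parameter `y` and only `A x` varies, so strong continuity of `A`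
-- gives the pointwise limit and the uniform bounds dominate.
theorem tendsto_integral_norm_sub (h : IsRegularFamily k A S S') (C : ℝ) (T : ℝ≥0) (y : ℝ)
    (d : F) :
    Tendsto (fun x => ∫ s in (0 : ℝ)..T,
      C * ‖A y (S' y s.toNNReal d) - A x (S' y s.toNNReal d)‖) (𝓝 y) (𝓝 0) := by
  obtain ⟨CA, hCA, hbA⟩ := h.bdd_A.exists_bound
  obtain ⟨C', hC', hb'⟩ := h.bdd'.exists_bound T
  have hAb : ∀ z, ∀ s : ℝ, s ≤ T → ‖A z (S' y s.toNNReal d)‖ ≤ CA * (C' * ‖d‖) := fun z s hs =>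
    (A z).le_of_opNorm_le_of_le (hbA z)
      ((S' y _).le_of_opNorm_le (hb' y _ (Real.toNNReal_le_iff_le_coe.2 hs)) d)
  have := intervalIntegral.tendsto_integral_filter_of_dominated_convergence (l := 𝓝 y)
    (μ := volume) (a := 0) (b := (T : ℝ))
    (F := fun x s => C * ‖A y (S' y s.toNNReal d) - A x (S' y s.toNNReal d)‖)
    (f := fun _ => (0 : ℝ)) (fun _ => |C| * (CA * (C' * ‖d‖) + CA * (C' * ‖d‖)))
    (Eventually.of_forall fun x => (((h.measurable_apply y y d).sub
      (h.measurable_apply x y d)).norm.const_mul C).aestronglyMeasurable)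
    (Eventually.of_forall fun x => Eventually.of_forall fun s hs => by
      rw [uIoc_of_le T.coe_nonneg] at hs
      rw [norm_mul, norm_norm, Real.norm_eq_abs]
      exact mul_le_mul_of_nonneg_left
        ((norm_sub_le _ _).trans (add_le_add (hAb y s hs.2) (hAb x s hs.2))) (abs_nonneg C))
    intervalIntegrable_const
    (Eventually.of_forall fun s _ => by
      have := (((h.bdd_A.2 (S' y s.toNNReal d)).tendsto y).const_sub
        (A y (S' y s.toNNReal d))).norm.const_mul C
      simpa using this)
  simpa using this

/-- Joint strong continuity of the semigroups in the parameter and in time. -/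
theorem continuous_uncurry (h : IsRegularFamily k A S S') :
    Continuous fun p : (ℝ × ℝ≥0) × E => S p.1.1 p.1.2 p.2 := by
  refine continuous_uncurry_apply (T := fun p : ℝ × ℝ≥0 => S p.1 p.2) h.dense (fun p => ?_) ?_
  · obtain ⟨C, hC⟩ := h.bdd (p.2 + 1)
    refine ⟨C, ?_⟩
    have := (continuous_snd.tendsto p).eventually (eventually_le_nhds (lt_add_one p.2))
    exact this.mono fun q hq => hC q.1 q.2 hq
  · rintro _ ⟨d, rfl⟩
    rw [continuous_iff_continuousAt]
    rintro ⟨y, t₀⟩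
    obtain ⟨C, hC, hb⟩ := h.bdd.exists_bound (t₀ + 1)
    have h1 : Tendsto (fun p : ℝ × ℝ≥0 => S p.1 p.2 (k d) - S y p.2 (k d)) (𝓝 (y, t₀)) (𝓝 0) := by
      refine squeeze_zero_norm' ?_ ((h.tendsto_integral_norm_sub C (t₀ + 1) y d).comp
        (continuous_fst.tendsto (y, t₀)))
      have := (continuous_snd.tendsto (y, t₀)).eventually (eventually_le_nhds (lt_add_one t₀))
      filter_upwards [this] with p hp
      rw [norm_sub_rev]
      exact h.norm_apply_sub_le hb p.1 y d hp
    have h2 : Tendsto (fun p : ℝ × ℝ≥0 => S y p.2 (k d)) (𝓝 (y, t₀)) (𝓝 (S y t₀ (k d))) :=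
      (((h.semigroup y).cont (k d)).comp continuous_snd).tendsto (y, t₀)
    simpa [ContinuousAt] using h1.add h2

theorem unifBoundedStronglyCont (h : IsRegularFamily k A S S') (t : ℝ≥0) :
    UnifBoundedStronglyCont fun x => S x t :=
  ⟨(h.bdd t).imp fun _ hC x => hC x t le_rfl, fun f => h.continuous_uncurry.comp
    (f := fun x : ℝ => ((x, t), f)) (by fun_prop)⟩

omit [CompleteSpace E] in
theorem norm_apply_sub_apply_le (h : IsRegularFamily k A S S') {C CA : ℝ} {T : ℝ≥0}
    (hb : ∀ x, ∀ t ≤ T, ‖S x t‖ ≤ C) (hA : ∀ x, ‖A x‖ ≤ CA) (x : ℝ) (d : F) {s t : ℝ≥0}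
    (hst : s ≤ t) (ht : t ≤ T) :
    ‖S x t (k d) - S x s (k d)‖ ≤ C * (CA * ‖d‖) * (t - s) := by
  have := norm_image_sub_le_of_norm_deriv_right_le_segment (a := (s : ℝ)) (b := t)
    (f := fun r : ℝ => S x r.toNNReal (k d)) (f' := fun r : ℝ => S x r.toNNReal (A x d))
    (C := C * (CA * ‖d‖)) ((h.semigroup x).continuous_real _).continuousOn
    (fun r hr => hasDerivWithinAt_Ioi_iff_Ici.1
      (hasDerivWithinAt_Ioi_apply (h.semigroup x) (h.gen x d) (s.coe_nonneg.trans hr.1)))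
    (fun r hr => (S x _).le_of_opNorm_le_of_le
      (hb x _ (Real.toNNReal_le_iff_le_coe.2 (hr.2.le.trans (NNReal.coe_le_coe.2 ht))))
      ((A x).le_of_opNorm_le (hA x) d)) t ⟨NNReal.coe_le_coe.2 hst, le_rfl⟩
  simpa using this

/-- The semigroup of multiplication by `S x t` in `C₀(ℝ, E)`. -/
def mulSemigroup (h : IsRegularFamily k A S S') (t : ℝ≥0) : C₀(ℝ, E) →L[𝕜] C₀(ℝ, E) :=
  mulC₀ (fun x => S x t) (h.unifBoundedStronglyCont t)

@[simp]
theorem mulSemigroup_apply (h : IsRegularFamily k A S S') (t : ℝ≥0) (f : C₀(ℝ, E)) (x : ℝ) :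
    h.mulSemigroup t f x = S x t (f x) := rfl

/-- On the dense image of `C₀(ℝ, F)` the orbits are Lipschitz in time uniformly in `x`, hence
continuous in the sup-norm; local boundedness extends this to all of `C₀(ℝ, E)`. -/
theorem isC0Semigroup_mulSemigroup [NormedSpace ℝ F] (h : IsRegularFamily k A S S') :
    IsC0Semigroup h.mulSemigroup where
  map_zero := by
    ext f x
    simp [(h.semigroup x).zero_apply]
  map_add s t := by
    ext f x
    simp [(h.semigroup x).add_apply]
  cont f := by
    refine (continuous_uncurry_apply (T := h.mulSemigroup) (denseRange_inclCLM h.dense)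
      (eventually_le_bound fun T => ?_) ?_).comp (continuous_id.prodMk continuous_const)
    · obtain ⟨C, hC, hb⟩ := h.bdd.exists_bound T
      exact ⟨C, fun t ht => norm_mulC₀_le _ _ hC fun x => hb x t ht⟩
    · rintro _ ⟨g, rfl⟩
      rw [continuous_iff_continuousAt]
      intro t₀
      obtain ⟨C, hC, hb⟩ := h.bdd.exists_bound (t₀ + 1)
      obtain ⟨CA, hCA, hbA⟩ := h.bdd_A.exists_bound
      have hlip : ∀ s t : ℝ≥0, s ≤ t → t ≤ t₀ + 1 →
          dist (h.mulSemigroup t (inclCLM k g)) (h.mulSemigroup s (inclCLM k g)) ≤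
            C * (CA * ‖g‖) * dist t s := by
        intro s t hst ht
        have hst' : (0 : ℝ) ≤ t - s := sub_nonneg.2 (NNReal.coe_le_coe.2 hst)
        rw [dist_eq_norm, NNReal.dist_eq, abs_of_nonneg hst']
        refine norm_le_of_apply_le (by positivity) fun x => ?_
        refine (h.norm_apply_sub_apply_le hb hbA x (g x) hst ht).trans ?_
        gcongr
        exact norm_apply_le g x
      have hz : Tendsto (fun t => C * (CA * ‖g‖) * dist t t₀) (𝓝 t₀) (𝓝 0) := by
        have : Continuous fun t : ℝ≥0 => C * (CA * ‖g‖) * dist t t₀ := by fun_prop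
        simpa using this.tendsto t₀
      refine tendsto_iff_dist_tendsto_zero.2 (squeeze_zero' (Eventually.of_forall fun _ =>
        dist_nonneg) ?_ hz)
      filter_upwards [eventually_le_nhds (lt_add_one t₀)] with t ht
      rcases le_total t₀ t with htt | htt
      · exact hlip t₀ t htt ht
      · rw [dist_comm, dist_comm t]
        exact hlip t t₀ htt (le_add_of_nonneg_right zero_le_one)

/-- Pointwise convergence of the quotients would not give convergence in sup-norm. The integrated
form of the generator avoids this: evaluation at `x` commutes with the integral and reduces it to `S
x`. -/
theorem mem_generatorGraph_mulSemigroup [NormedSpace ℝ F] (h : IsRegularFamily k A S S')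
    (f : C₀(ℝ, F)) : (inclCLM k f, mulC₀ A h.bdd_A f) ∈ generatorGraph h.mulSemigroup := by
  rw [mem_generatorGraph_iff h.isC0Semigroup_mulSemigroup]
  intro t ht
  ext x
  have h1 := ContinuousLinearMap.intervalIntegral_comp_comm (evalC₀ 𝕜 x)
    ((h.isC0Semigroup_mulSemigroup.continuous_real
      (mulC₀ A h.bdd_A f)).intervalIntegrable (μ := volume) 0 t)
  rw [evalC₀_apply] at h1
  rw [← h1]
  exact apply_sub_eq_integral (h.semigroup x) (h.gen x (f x)) ht

end IsRegularFamily

end Family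

/-! ### Measures on jump times and sizes; the first jump -/

section Simplex

theorem measurableSet_Sim (n : ℕ) (t : ℝ) : MeasurableSet (Sim n t) := by
  have : Sim n t = (⋂ i : Fin n, ⋂ k : Fin n, ⋂ _ : i < k, {s : Fin n → ℝ | s i < s k}) ∩
      ⋂ k : Fin n, ({s : Fin n → ℝ | 0 < s k} ∩ {s | s k < t}) := by
    ext s
    simp only [Sim, StrictMono, mem_inter_iff, mem_iInter, mem_ofPred_eq]
  rw [this]
  refine (MeasurableSet.iInter fun i => MeasurableSet.iInter fun k => MeasurableSet.iInter fun _ =>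
    measurableSet_lt (measurable_pi_apply i) (measurable_pi_apply k)).inter
    (MeasurableSet.iInter fun k => ?_)
  exact (measurableSet_lt measurable_const (measurable_pi_apply k)).inter
    (measurableSet_lt (measurable_pi_apply k) measurable_const)

theorem mem_Sim_succ {n : ℕ} {t : ℝ} {s : Fin (n + 1) → ℝ} :
    s ∈ Sim (n + 1) t ↔ s 0 ∈ Ioo 0 t ∧ (fun k : Fin n => s k.succ - s 0) ∈ Sim n (t - s 0) := by
  constructor
  · rintro ⟨hm, hs⟩
    refine ⟨hs 0, fun i k hik => sub_lt_sub_right (hm (Fin.succ_lt_succ_iff.2 hik)) _,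
      fun k => ⟨sub_pos.2 (hm k.succ_pos), sub_lt_sub_right (hs _).2 _⟩⟩
  · rintro ⟨h0, hm, hs⟩
    have hlt : ∀ k : Fin n, s 0 < s k.succ := fun k => sub_pos.1 (hs k).1
    refine ⟨fun i k hik => ?_, fun k => ?_⟩
    · induction k using Fin.cases with
      | zero => exact absurd hik (Fin.not_lt_zero i)
      | succ k =>
        induction i using Fin.cases with
        | zero => exact hlt k
        | succ i => exact (sub_lt_sub_iff_right _).1 (hm (Fin.succ_lt_succ_iff.1 hik))
    · induction k using Fin.cases with
      | zero => exact h0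
      | succ k => exact ⟨h0.1.trans (hlt k), (sub_lt_sub_iff_right _).1 (hs k).2⟩

/-- The measure `ds₁ ⋯ dsₙ ν(dz₁) ⋯ ν(dzₙ)` for jump times in the simplex. -/
def simplexMeasure (ν : Measure ℝ) (n : ℕ) (t : ℝ) : Measure ((Fin n → ℝ) × (Fin n → ℝ)) :=
  (volume.restrict (Sim n t)).prod (Measure.pi fun _ : Fin n => ν)

variable (ν : Measure ℝ) [IsFiniteMeasure ν]

theorem simplexMeasure_eq_restrict (n : ℕ) (t : ℝ) : simplexMeasure ν n t =
    ((volume : Measure (Fin n → ℝ)).prod (Measure.pi fun _ : Fin n => ν)).restrict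
      (Sim n t ×ˢ univ) := by
  rw [simplexMeasure, ← Measure.prod_restrict, Measure.restrict_univ]

theorem volume_Sim_lt_top (n : ℕ) (t : ℝ) : volume (Sim n t) < ⊤ :=
  lt_of_le_of_lt (measure_mono (t := Icc (fun _ => 0) fun _ => t) fun _ hs =>
    ⟨fun k => (hs.2 k).1.le, fun k => (hs.2 k).2.le⟩) isCompact_Icc.measure_lt_top

instance (n : ℕ) (t : ℝ) :
    IsFiniteMeasure (Measure.comap Subtype.val volume : Measure (Sim n t)) := by
  refine ⟨?_⟩
  rw [comap_subtype_coe_apply (measurableSet_Sim n t), image_univ, Subtype.range_coe]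
  exact volume_Sim_lt_top n t

instance (n : ℕ) (t : ℝ) : IsFiniteMeasure (simplexMeasure ν n t) := by
  have : IsFiniteMeasure ((volume : Measure (Fin n → ℝ)).restrict (Sim n t)) :=
    isFiniteMeasure_restrict.2 (volume_Sim_lt_top n t).ne
  rw [simplexMeasure]
  infer_instance

omit [IsFiniteMeasure ν] in
theorem ae_simplexMeasure (n : ℕ) (t : ℝ) : ∀ᵐ w ∂simplexMeasure ν n t, w.1 ∈ Sim n t :=
  Measure.quasiMeasurePreserving_fst.ae (ae_restrict_mem (measurableSet_Sim n t))

/-- Attaches a first jump, with time and size `p.1`, to a path. -/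
def attachJump {n : ℕ} (p : (ℝ × ℝ) × (Fin n → ℝ) × (Fin n → ℝ)) :
    (Fin (n + 1) → ℝ) × (Fin (n + 1) → ℝ) :=
  (Fin.cons (α := fun _ => ℝ) p.1.1 fun k => p.2.1 k + p.1.1,
    Fin.cons (α := fun _ => ℝ) p.1.2 p.2.2)

theorem measurePreserving_cons (μ : Measure ℝ) [SigmaFinite μ] (n : ℕ) :
    MeasurePreserving (fun p : ℝ × (Fin n → ℝ) => Fin.cons (α := fun _ : Fin (n + 1) => ℝ) p.1 p.2)
      (μ.prod (Measure.pi fun _ : Fin n => μ)) (Measure.pi fun _ : Fin (n + 1) => μ) := by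
  have h := (measurePreserving_piFinSuccAbove (fun _ : Fin (n + 1) => μ) 0).symm
  convert h using 1
  funext p
  simp only [MeasurableEquiv.piFinSuccAbove, Fin.insertNthEquiv_zero]
  rfl

theorem measurePreserving_prodComm {α β γ δ : Type*} [MeasurableSpace α] [MeasurableSpace β]
    [MeasurableSpace γ] [MeasurableSpace δ] (μa : Measure α) (μb : Measure β) (μc : Measure γ)
    (μd : Measure δ) [SFinite μa] [SFinite μb] [SFinite μc] [SFinite μd] :
    MeasurePreserving (fun p : (α × β) × γ × δ => ((p.1.1, p.2.1), (p.1.2, p.2.2)))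
      ((μa.prod μb).prod (μc.prod μd)) ((μa.prod μc).prod (μb.prod μd)) := by
  have h1 := measurePreserving_prodAssoc μa μb (μc.prod μd)
  have h2 := (measurePreserving_prodAssoc μb μc μd).symm
  have h3 : MeasurePreserving (Prod.map Prod.swap id) ((μb.prod μc).prod μd)
    ((μc.prod μb).prod μd) := Measure.measurePreserving_swap.prod (MeasurePreserving.id μd)
  have h4 := measurePreserving_prodAssoc μc μb μd
  have h5 := (MeasurePreserving.id μa).prod (h4.comp (h3.comp h2))
  have h6 := (measurePreserving_prodAssoc μa μc (μb.prod μd)).symm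
  exact h6.comp (h5.comp h1)

/-- Shifting the later times by the first one is a shear, which preserves Lebesgue measure; the rest
only reorders factors. -/
theorem measurePreserving_attachJump (n : ℕ) :
    MeasurePreserving (attachJump (n := n))
      ((volume.prod ν).prod (volume.prod (Measure.pi fun _ : Fin n => ν)))
      (volume.prod (Measure.pi fun _ : Fin (n + 1) => ν)) := by
  have hs : MeasurePreserving (fun p : ℝ × (Fin n → ℝ) => (p.1, fun k => p.2 k + p.1))
      ((volume : Measure ℝ).prod volume) (volume.prod volume) := by
    refine (MeasurePreserving.id volume).skew_product (g := fun (r : ℝ) (s : Fin n → ℝ) =>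
      fun k => s k + r) ?_ (Eventually.of_forall fun r => ?_)
    · exact measurable_pi_iff.2 fun k =>
        ((measurable_pi_apply k).comp measurable_snd).add measurable_fst
    · exact map_add_right_eq_self volume fun _ : Fin n => r
  exact (((measurePreserving_cons volume n).comp hs).prod (measurePreserving_cons ν n)).comp
    (measurePreserving_prodComm volume ν volume _)

theorem attachJump_mem {n : ℕ} {t : ℝ} (p : (ℝ × ℝ) × (Fin n → ℝ) × (Fin n → ℝ)) :
    (attachJump p).1 ∈ Sim (n + 1) t ↔ p.1.1 ∈ Ioo 0 t ∧ p.2.1 ∈ Sim n (t - p.1.1) := by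
  rw [mem_Sim_succ]
  simp [attachJump]

/-- Integration over the paths with `n + 1` jumps by conditioning on the first jump. -/
theorem integral_simplexMeasure_succ {G : Type*} [NormedAddCommGroup G] [NormedSpace ℝ G] {n : ℕ}
    {t : ℝ} {f : (Fin (n + 1) → ℝ) × (Fin (n + 1) → ℝ) → G}
    (hf : Integrable f (simplexMeasure ν (n + 1) t)) :
    Integrable (fun q : ℝ × ℝ => ∫ w, f (attachJump (q, w)) ∂simplexMeasure ν n (t - q.1))
      ((volume.restrict (Ioo 0 t)).prod ν) ∧
    ∫ w, f w ∂simplexMeasure ν (n + 1) t =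
      ∫ q, ∫ w, f (attachJump (q, w)) ∂simplexMeasure ν n (t - q.1)
        ∂((volume.restrict (Ioo 0 t)).prod ν) := by
  have hS : ∀ n t, MeasurableSet (Sim n t ×ˢ (univ : Set (Fin n → ℝ))) := fun n t =>
    (measurableSet_Sim n t).prod .univ
  have hI : MeasurableSet (Ioo 0 t ×ˢ (univ : Set ℝ)) := measurableSet_Ioo.prod .univ
  have hm := measurePreserving_attachJump ν n
  have hI' : (volume.restrict (Ioo 0 t)).prod ν = (volume.prod ν).restrict (Ioo 0 t ×ˢ univ) := by
    rw [← Measure.prod_restrict, Measure.restrict_univ]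
  rw [simplexMeasure_eq_restrict] at hf ⊢
  set g := (Sim (n + 1) t ×ˢ univ).indicator f with hg
  have hgi : Integrable g (volume.prod (Measure.pi fun _ : Fin (n + 1) => ν)) :=
    (integrable_indicator_iff (hS _ _)).2 hf
  have hgi' := hm.integrable_comp_of_integrable hgi
  -- The inner simplex depends on the first jump time. Extending `f` by zero to the whole product
  -- removes this dependence, and Fubini applies there.
  have hin : (fun q : ℝ × ℝ => ∫ w, (g ∘ attachJump) (q, w)
        ∂(volume.prod (Measure.pi fun _ : Fin n => ν))) =
      (Ioo 0 t ×ˢ univ).indicator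
        fun q => ∫ w, f (attachJump (q, w)) ∂simplexMeasure ν n (t - q.1) := by
    funext q
    by_cases hq : q.1 ∈ Ioo 0 t
    · rw [indicator_of_mem (by exact ⟨hq, mem_univ _⟩), simplexMeasure_eq_restrict,
        ← integral_indicator (hS _ _)]
      refine integral_congr_ae (Eventually.of_forall fun w => ?_)
      have hiff : attachJump (q, w) ∈ Sim (n + 1) t ×ˢ (univ : Set (Fin (n + 1) → ℝ)) ↔
          w ∈ Sim n (t - q.1) ×ˢ (univ : Set (Fin n → ℝ)) := by
        simp only [Set.mem_prod, mem_univ, and_true, attachJump_mem, hq, true_and]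
      by_cases hw : w ∈ Sim n (t - q.1) ×ˢ (univ : Set (Fin n → ℝ))
      · simp only [Function.comp_apply, hg, indicator_of_mem hw, indicator_of_mem (hiff.2 hw)]
      · simp only [Function.comp_apply, hg, indicator_of_notMem hw,
          indicator_of_notMem (mt hiff.1 hw)]
    · rw [indicator_of_notMem (by simpa using hq)]
      refine integral_eq_zero_of_ae (Eventually.of_forall fun w => ?_)
      simp only [Function.comp_apply, hg, indicator, Set.mem_prod, mem_univ, and_true,
        attachJump_mem, hq, false_and, if_false, Pi.zero_apply]
  have h1 := hgi'.integral_prod_left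
  rw [hin, integrable_indicator_iff hI] at h1
  rw [hI']
  refine ⟨h1, ?_⟩
  rw [← integral_indicator (hS _ _), ← hg, ← hm.map_eq, integral_map hm.measurable.aemeasurable
    (by rw [hm.map_eq]; exact hgi.aestronglyMeasurable), ← integral_indicator hI, ← hin]
  exact integral_prod _ hgi'

omit [IsFiniteMeasure ν] in
theorem ae_prod_Ioo (t : ℝ) : ∀ᵐ q ∂((volume.restrict (Ioo 0 t)).prod ν), q.1 ∈ Ioo 0 t :=
  Measure.quasiMeasurePreserving_fst.ae (ae_restrict_mem measurableSet_Ioo)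

/-- Conditioning on the first jump, each mass is `ν.real univ` times the time integral of the
preceding one. -/
theorem simplexMeasure_real_univ (n : ℕ) {t : ℝ} (ht : 0 ≤ t) :
    (simplexMeasure ν n t).real univ = (t * ν.real univ) ^ n / n.factorial := by
  induction n generalizing t with
  | zero =>
    have : Sim 0 t = univ := eq_univ_of_forall fun s => ⟨fun i => i.elim0, fun i => i.elim0⟩
    rw [simplexMeasure, this, Measure.restrict_univ, measureReal_def, ← univ_prod_univ,
      Measure.prod_prod]
    simp [volume_pi]
  | succ n ih =>
    have h := (integral_simplexMeasure_succ ν (n := n) (t := t) (f := fun _ => (1 : ℝ))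
      (integrable_const _)).2
    simp only [integral_const, smul_eq_mul, mul_one] at h
    rw [h, integral_congr_ae (g := fun q => ((t - q.1) * ν.real univ) ^ n / n.factorial)
      ((ae_prod_Ioo ν t).mono fun q hq => ih (sub_nonneg.2 hq.2.le)),
      integral_fun_fst (f := fun r => ((t - r) * ν.real univ) ^ n / n.factorial),
      ← integral_Ioc_eq_integral_Ioo, ← intervalIntegral.integral_of_le ht,
      intervalIntegral.integral_comp_sub_left (fun r => (r * ν.real univ) ^ n / n.factorial) t,
      sub_self, sub_zero]
    simp only [mul_pow, mul_div_assoc]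
    rw [intervalIntegral.integral_mul_const, integral_pow, Nat.factorial_succ]
    have : (n.factorial : ℝ) ≠ 0 := by positivity
    push_cast
    simp only [smul_eq_mul]
    field_simp
    ring

end Simplex

/-! ### Path values and the terms of the Dyson series -/

section PathValue

variable {𝕜 E : Type*} [RCLike 𝕜] [NormedAddCommGroup E] [NormedSpace 𝕜 E]

/-- The value `T exp {∫₀ᵗ A(Z_x(τ)) dτ} Y(Z_x(t))` along the path with jump times `s` and jump
sizes `z`, computed recursively from the first jump. -/
def pathVal (S : ℝ → ℝ≥0 → E →L[𝕜] E) (Y : ℝ → E) :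
    (n : ℕ) → ℝ → ℝ → (Fin n → ℝ) → (Fin n → ℝ) → E
  | 0, t, x, _, _ => S x t.toNNReal (Y x)
  | n + 1, t, x, s, z => S x (s 0).toNNReal
      (pathVal S Y n (t - s 0) (x - z 0) (fun k => s k.succ - s 0) fun k => z k.succ)

theorem continuous_pathVal {S : ℝ → ℝ≥0 → E →L[𝕜] E}
    (hS : Continuous fun p : (ℝ × ℝ≥0) × E => S p.1.1 p.1.2 p.2) {Y : ℝ → E} (hY : Continuous Y)
    (n : ℕ) : Continuous fun p : ℝ × ℝ × (Fin n → ℝ) × (Fin n → ℝ) =>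
      pathVal S Y n p.1 p.2.1 p.2.2.1 p.2.2.2 := by
  induction n with
  | zero =>
    exact hS.comp (f := fun p : ℝ × ℝ × (Fin 0 → ℝ) × (Fin 0 → ℝ) =>
      ((p.2.1, p.1.toNNReal), Y p.2.1)) (by fun_prop)
  | succ n ih =>
    have h1 : Continuous fun p : ℝ × ℝ × (Fin (n + 1) → ℝ) × (Fin (n + 1) → ℝ) =>
        ((p.1 - p.2.2.1 0, p.2.1 - p.2.2.2 0, (fun k : Fin n => p.2.2.1 k.succ - p.2.2.1 0),
          fun k : Fin n => p.2.2.2 k.succ) : ℝ × ℝ × (Fin n → ℝ) × (Fin n → ℝ)) := by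
      fun_prop
    have h2 : Continuous fun p : ℝ × ℝ × (Fin (n + 1) → ℝ) × (Fin (n + 1) → ℝ) =>
        (p.2.1, (p.2.2.1 0).toNNReal) := by fun_prop
    exact hS.comp (h2.prodMk (ih.comp h1))

theorem norm_pathVal_le {S : ℝ → ℝ≥0 → E →L[𝕜] E} {C K : ℝ} {T : ℝ≥0}
    (hb : ∀ x, ∀ t ≤ T, ‖S x t‖ ≤ C) {Y : ℝ → E} (hY : ∀ x, ‖Y x‖ ≤ K) (n : ℕ) {t : ℝ}
    (ht : t ≤ T) (x : ℝ) {s : Fin n → ℝ} (hs : s ∈ Sim n t) (z : Fin n → ℝ) :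
    ‖pathVal S Y n t x s z‖ ≤ C ^ (n + 1) * K := by
  induction n generalizing t x with
  | zero =>
    simpa [pathVal] using (S x _).le_of_opNorm_le_of_le (hb x _ (Real.toNNReal_le_iff_le_coe.2 ht))
      (hY x)
  | succ n ih =>
    obtain ⟨h0, hs'⟩ := mem_Sim_succ.1 hs
    refine ((S x _).le_of_opNorm_le_of_le
      (hb x _ (Real.toNNReal_le_iff_le_coe.2 (h0.2.le.trans ht)))
      (ih (by linarith [h0.1]) _ hs' _)).trans_eq ?_
    ring

theorem integrable_pathVal (ν : Measure ℝ) [IsFiniteMeasure ν] {S : ℝ → ℝ≥0 → E →L[𝕜] E}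
    (hS : Continuous fun p : (ℝ × ℝ≥0) × E => S p.1.1 p.1.2 p.2) (hb : UnifBounded S)
    (Y : C₀(ℝ, E)) (n : ℕ) (t x : ℝ) :
    Integrable (fun w => pathVal S Y n t x w.1 w.2) (simplexMeasure ν n t) := by
  obtain ⟨C, hC, hb⟩ := hb.exists_bound t.toNNReal
  refine Integrable.of_bound ((continuous_pathVal hS Y.continuous n).comp
    (continuous_const.prodMk (continuous_const.prodMk continuous_id))).aestronglyMeasurable
    (C ^ (n + 1) * ‖Y‖) ((ae_simplexMeasure ν n t).mono fun w hw => ?_)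
  exact norm_pathVal_le hb (norm_apply_le Y) n (Real.le_coe_toNNReal t) x hw w.2

variable [NormedSpace ℝ E] [CompleteSpace E]

/-- The terms of the Dyson series as integrals over the paths with `n` jumps. -/
theorem dyson_apply_eq_integral {F : Type*} [NormedAddCommGroup F] [NormedSpace 𝕜 F]
    [NormedSpace ℝ F] {k : F →L[𝕜] E} {A : ℝ → F →L[𝕜] E} {S : ℝ → ℝ≥0 → E →L[𝕜] E}
    {S' : ℝ → ℝ≥0 → F →L[𝕜] F} (h : IsRegularFamily k A S S') (ν : Measure ℝ) [IsFiniteMeasure ν]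
    (Y : C₀(ℝ, E)) (n : ℕ) {t : ℝ} (ht : 0 ≤ t) (x : ℝ) :
    dyson h.mulSemigroup (convC₀ 𝕜 ν) n t Y x =
      ∫ w, pathVal S Y n t x w.1 w.2 ∂simplexMeasure ν n t := by
  induction n generalizing t x with
  | zero =>
    have h1 := simplexMeasure_real_univ ν 0 ht
    have : ∀ w : (Fin 0 → ℝ) × (Fin 0 → ℝ), pathVal S Y 0 t x w.1 w.2 = S x t.toNNReal (Y x) :=
      fun _ => rfl
    simp only [this, integral_const, h1]
    simp [dyson]
  | succ n ih =>
    have hM := h.isC0Semigroup_mulSemigroup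
    obtain ⟨hi, he⟩ := integral_simplexMeasure_succ ν
      (integrable_pathVal ν h.continuous_uncurry h.bdd Y (n + 1) t x)
    -- Given a first jump `q = (r, z)`, the operator `S x r` comes out of the integral, leaving by
    -- induction the `n`-th term at time `t - r` and point `x - z`.
    have hq : (fun q : ℝ × ℝ => ∫ w, pathVal S Y (n + 1) t x (attachJump (q, w)).1
          (attachJump (q, w)).2 ∂simplexMeasure ν n (t - q.1)) =ᵐ[(volume.restrict (Ioo 0 t)).prod ν]
        fun q => S x q.1.toNNReal
          (dyson h.mulSemigroup (convC₀ 𝕜 ν) n (t - q.1) Y (x - q.2)) := by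
      filter_upwards [ae_prod_Ioo ν t] with q hq
      rw [ih (sub_nonneg.2 hq.2.le), ← ContinuousLinearMap.integral_comp_comm _
        (integrable_pathVal ν h.continuous_uncurry h.bdd Y n _ _)]
      simp [pathVal, attachJump]
    rw [he, integral_congr_ae hq, integral_prod _ (hi.congr hq), ← integral_Ioc_eq_integral_Ioo,
      ← intervalIntegral.integral_of_le ht]
    have h1 := ContinuousLinearMap.intervalIntegral_comp_comm (evalC₀ 𝕜 x)
      ((continuous_convolution_right hM (N := convC₀ 𝕜 ν)
        (continuous_dyson hM (N := convC₀ 𝕜 ν) n Y) t).intervalIntegrable (μ := volume) 0 t)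
    rw [evalC₀_apply] at h1
    rw [dyson, ← h1]
    -- In the Dyson recursion the outer factor acts for time `t - r`; reflecting `r` to `t - r`
    -- makes this the first jump time.
    have h2 := intervalIntegral.integral_comp_sub_left (a := 0) (b := t)
      (fun r => evalC₀ 𝕜 x (h.mulSemigroup (t - r).toNNReal
        (convC₀ 𝕜 ν (dyson h.mulSemigroup (convC₀ 𝕜 ν) n r Y)))) t
    rw [sub_self, sub_zero] at h2
    rw [← h2]
    refine intervalIntegral.integral_congr fun r _ => ?_
    simp only [evalC₀_apply, IsRegularFamily.mulSemigroup_apply, convC₀_apply, sub_sub_cancel]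
    exact (ContinuousLinearMap.integral_comp_comm _ (integrable_apply_sub ν _ x)).symm

end PathValue

/-! ### The chronological exponential and the law on path space -/

section PathSpace

variable {𝕜 E : Type*} [RCLike 𝕜] [NormedAddCommGroup E] [NormedSpace 𝕜 E]

theorem path_mk_succ {n : ℕ} {t : ℝ} {s : Fin (n + 1) → ℝ} (hs : s ∈ Sim (n + 1) t)
    (z : Fin (n + 1) → ℝ) (x : ℝ) {τ : ℝ} (hτ : s 0 ≤ τ) :
    PC.path (⟨n + 1, ⟨s, hs⟩, z⟩ : PC t) x τ =
      PC.path (⟨n, ⟨_, (mem_Sim_succ.1 hs).2⟩, fun k => z k.succ⟩ : PC (t - s 0)) (x - z 0)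
        (τ - s 0) := by
  simp only [PC.path, Fin.sum_univ_succ, if_pos hτ, sub_le_sub_iff_right]
  ring

theorem path_mk_zero {n : ℕ} {t : ℝ} {s : Fin n → ℝ} (hs : s ∈ Sim n t)
    (z : Fin n → ℝ) (x : ℝ) : PC.path (⟨n, ⟨s, hs⟩, z⟩ : PC t) x 0 = x := by
  simp [PC.path, fun k => not_le.2 (hs.2 k).1]

/-- Restarting the clock at the first jump leaves a path from `x - z 0` whose constancy intervals
have the same lengths, so only the first factor splits off. -/
theorem chronExp_mk_succ (S : ℝ → ℝ≥0 → E →L[𝕜] E) {n : ℕ} {t : ℝ} {s : Fin (n + 1) → ℝ}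
    (hs : s ∈ Sim (n + 1) t) (z : Fin (n + 1) → ℝ) (x : ℝ) :
    PC.chronExp S (⟨n + 1, ⟨s, hs⟩, z⟩ : PC t) x = S x (s 0).toNNReal *
      PC.chronExp S (⟨n, ⟨_, (mem_Sim_succ.1 hs).2⟩, fun k => z k.succ⟩ : PC (t - s 0))
        (x - z 0) := by
  have hleft : ∀ k : Fin (n + 1),
      PC.left (⟨n, ⟨_, (mem_Sim_succ.1 hs).2⟩, fun k => z k.succ⟩ : PC (t - s 0)) k =
        s k - s 0 := by
    intro k
    induction k using Fin.cases with
    | zero => simp [PC.left]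
    | succ k => simp [PC.left]
  have hright : ∀ k : Fin (n + 1),
      PC.right (⟨n, ⟨_, (mem_Sim_succ.1 hs).2⟩, fun k => z k.succ⟩ : PC (t - s 0)) k =
        PC.right (⟨n + 1, ⟨s, hs⟩, z⟩ : PC t) k.succ - s 0 := by
    intro k
    induction k using Fin.lastCases with
    | last => simp [PC.right]
    | cast k => simp only [PC.right, Fin.snoc_castSucc, Fin.succ_castSucc]
  have hr0 : PC.right (⟨n + 1, ⟨s, hs⟩, z⟩ : PC t) 0 = s 0 := by
    exact Fin.snoc_castSucc (α := fun _ => ℝ) t s 0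
  have hl0 : PC.left (⟨n + 1, ⟨s, hs⟩, z⟩ : PC t) 0 = 0 := by simp [PC.left]
  have hl : ∀ k : Fin (n + 1), PC.left (⟨n + 1, ⟨s, hs⟩, z⟩ : PC t) k.succ = s k := by
    intro k; simp [PC.left]
  simp only [PC.chronExp]
  rw [List.ofFn_succ, List.prod_cons, hl0, hr0, path_mk_zero, sub_zero]
  congr 3
  funext k
  rw [hl, hleft, hright, path_mk_succ hs z x (hs.1.monotone (Fin.zero_le k)),
    sub_sub_sub_cancel_right]

theorem chronExp_apply (S : ℝ → ℝ≥0 → E →L[𝕜] E) (Y : ℝ → E) {n : ℕ} {t : ℝ} {s : Fin n → ℝ}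
    (hs : s ∈ Sim n t) (z : Fin n → ℝ) (x : ℝ) :
    PC.chronExp S (⟨n, ⟨s, hs⟩, z⟩ : PC t) x (Y (PC.path (⟨n, ⟨s, hs⟩, z⟩ : PC t) x t)) =
      pathVal S Y n t x s z := by
  induction n generalizing t x with
  | zero => simp [PC.chronExp, PC.path, PC.left, PC.right, pathVal, Fin.snoc]
  | succ n ih =>
    rw [chronExp_mk_succ, path_mk_succ hs z x (hs.2 0).2.le, mul_apply_eq_comp,
      ih]
    rfl

/-- The preimage in another fibre of an image from fibre `a` is empty, so images of measurable sets
are measurable and integrals transfer fibre by fibre. -/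
theorem measurableEmbedding_sigmaMk {ι : Type*} {α : ι → Type*} [∀ a, MeasurableSpace (α a)]
    (a : ι) : MeasurableEmbedding (Sigma.mk a : α a → Σ a, α a) where
  injective := sigma_mk_injective
  measurable := Measurable.of_le_map (iInf_le _ a)
  measurableSet_image' s hs := by
    classical
    refine MeasurableSpace.measurableSet_iInf.2 fun b => ?_
    change MeasurableSet (Sigma.mk b ⁻¹' (Sigma.mk a '' s))
    by_cases hb : b = a
    · subst hb
      rwa [preimage_image_eq _ sigma_mk_injective]
    · have : Sigma.mk b ⁻¹' (Sigma.mk a '' s) = ∅ := by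
        ext y
        simp only [mem_preimage, mem_image, mem_empty_iff_false, iff_false, not_exists, not_and]
        rintro w - h
        exact hb (congrArg Sigma.fst h).symm
      rw [this]
      exact .empty

variable (ν : Measure ℝ) [IsFiniteMeasure ν]

theorem measurePreserving_coe_prod (n : ℕ) (t : ℝ) :
    MeasurePreserving (Prod.map ((↑) : Sim n t → Fin n → ℝ) (id : (Fin n → ℝ) → Fin n → ℝ))
      ((Measure.comap Subtype.val volume).prod (Measure.pi fun _ : Fin n => ν))
      (simplexMeasure ν n t) :=
  (measurePreserving_subtype_coe (measurableSet_Sim n t)).prod (MeasurePreserving.id _)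

theorem measurableEmbedding_coe_prod (n : ℕ) (t : ℝ) :
    MeasurableEmbedding (Prod.map ((↑) : Sim n t → Fin n → ℝ) (id : (Fin n → ℝ) → Fin n → ℝ)) :=
  (MeasurableEmbedding.subtype_coe (measurableSet_Sim n t)).prodMap .id

/-- The number of jumps has the Poisson weights of parameter `t * ν.real univ`, which sum to one. -/
theorem pathLaw_univ {t : ℝ} (ht : 0 ≤ t) : pathLaw ν t univ = 1 := by
  have h : ∀ n, Measure.map (Sigma.mk n)
      ((Measure.comap Subtype.val volume : Measure (Sim n t)).prod
        (Measure.pi fun _ : Fin n => ν)) (univ : Set (PC t)) =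
      ENNReal.ofReal ((t * ν.real univ) ^ n / n.factorial) := by
    intro n
    rw [(measurableEmbedding_sigmaMk n).map_apply, preimage_univ, ← simplexMeasure_real_univ ν n ht,
      ofReal_measureReal, ← (measurePreserving_coe_prod ν n t).map_eq,
      (measurableEmbedding_coe_prod n t).map_apply, preimage_univ]
  have hs := NormedSpace.expSeries_div_hasSum_exp (𝔸 := ℝ) (t * ν.real univ)
  rw [← Real.exp_eq_exp_ℝ] at hs
  rw [pathLaw, Measure.smul_apply, pathMeasure, Measure.sum_apply _ .univ]
  simp only [h]
  rw [← ENNReal.ofReal_tsum_of_nonneg (fun n => by positivity) hs.summable, hs.tsum_eq, smul_eq_mul,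
    ← ENNReal.ofReal_mul (Real.exp_nonneg _), ← Real.exp_add, neg_add_cancel, Real.exp_zero,
    ENNReal.ofReal_one]

theorem integral_pathLaw [NormedSpace ℝ E] {S : ℝ → ℝ≥0 → E →L[𝕜] E}
    (hS : Continuous fun p : (ℝ × ℝ≥0) × E => S p.1.1 p.1.2 p.2) (hb : UnifBounded S)
    (Y : C₀(ℝ, E)) {t : ℝ} (ht : 0 ≤ t) (x : ℝ) :
    Integrable (fun p : PC t => p.chronExp S x (Y (p.path x t))) (pathLaw ν t) ∧
    HasSum (fun n => Real.exp (-(t * ν.real univ)) •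
        ∫ w, pathVal S Y n t x w.1 w.2 ∂simplexMeasure ν n t)
      (∫ p : PC t, p.chronExp S x (Y (p.path x t)) ∂pathLaw ν t) := by
  set f : PC t → E := fun p => p.chronExp S x (Y (p.path x t)) with hf
  have hcomp : ∀ n, (fun u => f (Sigma.mk n u)) =
      (fun w : (Fin n → ℝ) × (Fin n → ℝ) => pathVal S Y n t x w.1 w.2) ∘ Prod.map (↑) id :=
    fun n => funext fun u => chronExp_apply S Y u.1.2 u.2 x
  have hint : ∀ n, Integrable f (Measure.map (Sigma.mk n)
      ((Measure.comap Subtype.val volume : Measure (Sim n t)).prod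
        (Measure.pi fun _ : Fin n => ν))) := by
    intro n
    rw [(measurableEmbedding_sigmaMk n).integrable_map_iff]
    change Integrable (fun u => f (Sigma.mk n u)) _
    rw [hcomp]
    exact (measurePreserving_coe_prod ν n t).integrable_comp_of_integrable
      (integrable_pathVal ν hS hb Y n t x)
  have hI : Integrable f (pathMeasure ν t) := by
    obtain ⟨C, hC, hb⟩ := hb.exists_bound t.toNNReal
    -- Summability over `n`: with `n` jumps the integrand is at most `C ^ (n + 1) * ‖Y‖` and the
    -- mass is `(t * ν.real univ) ^ n / n!`.
    refine integrable_sum_measure hint (Summable.of_nonneg_of_le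
      (fun n => integral_nonneg fun _ => norm_nonneg _) (fun n => ?_)
      (summable_dyson_bound C (ν.real univ) t (C * ‖Y‖)))
    rw [(measurableEmbedding_sigmaMk n).integral_map]
    have : (fun u => ‖f (Sigma.mk n u)‖) =
      (fun w : (Fin n → ℝ) × (Fin n → ℝ) => ‖pathVal S Y n t x w.1 w.2‖) ∘ Prod.map (↑) id :=
        funext fun u => congrArg norm (congrFun (hcomp n) u)
    rw [this]
    refine ((measurePreserving_coe_prod ν n t).integral_comp (measurableEmbedding_coe_prod n t)
      fun w => ‖pathVal S Y n t x w.1 w.2‖).trans_le ?_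
    refine (integral_mono_of_nonneg (Eventually.of_forall fun _ => norm_nonneg _)
      (integrable_const (C ^ (n + 1) * ‖Y‖)) ((ae_simplexMeasure ν n t).mono fun w hw =>
        norm_pathVal_le hb (norm_apply_le Y) n (Real.le_coe_toNNReal t) x hw w.2)).trans_eq ?_
    rw [integral_const, simplexMeasure_real_univ ν n ht, smul_eq_mul]
    simp only [mul_pow]
    ring
  refine ⟨hI.smul_measure ENNReal.ofReal_ne_top, ?_⟩
  rw [pathLaw, integral_smul_measure, ENNReal.toReal_ofReal (Real.exp_nonneg _)]
  refine HasSum.const_smul _ ?_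
  have he : ∀ n, ∫ p, f p ∂Measure.map (Sigma.mk n)
      ((Measure.comap Subtype.val volume : Measure (Sim n t)).prod
        (Measure.pi fun _ : Fin n => ν)) =
      ∫ w, pathVal S Y n t x w.1 w.2 ∂simplexMeasure ν n t := by
    intro n
    rw [(measurableEmbedding_sigmaMk n).integral_map, hcomp]
    exact (measurePreserving_coe_prod ν n t).integral_comp (measurableEmbedding_coe_prod n t)
      fun w => pathVal S Y n t x w.1 w.2
  have hs := hasSum_integral_measure hI
  simp only [he] at hs
  exact hs

end PathSpace

/-! ### The semigroup of the full operator -/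

section MainConstruction

variable {𝕜 B D : Type*} [RCLike 𝕜] [NormedAddCommGroup B] [NormedSpace 𝕜 B] [NormedSpace ℝ B]
  [CompleteSpace B] [NormedAddCommGroup D] [NormedSpace 𝕜 D]

/-- The operator `A(·) - D₊^(ν)` on `C₀(ℝ, D)`. -/
def operatorCLM (i : D →L[𝕜] B) {A : ℝ → D →L[𝕜] B} (hA : UnifBoundedStronglyCont A)
    (ν : Measure ℝ) [IsFiniteMeasure ν] : C₀(ℝ, D) →L[𝕜] C₀(ℝ, B) :=
  mulC₀ A hA + (convC₀ 𝕜 ν).comp (inclCLM i) - ((ν.real univ : ℝ) : 𝕜) • inclCLM i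

theorem operatorCLM_apply (i : D →L[𝕜] B) {A : ℝ → D →L[𝕜] B} (hA : UnifBoundedStronglyCont A)
    (ν : Measure ℝ) [IsFiniteMeasure ν] (f : C₀(ℝ, D)) (x : ℝ) :
    operatorCLM i hA ν f x = A x (f x) - Dplus ν (inclC₀ i f) x := by
  rw [sub_eq_add_neg, neg_Dplus_apply (𝕜 := 𝕜), RCLike.real_smul_eq_coe_smul (K := 𝕜), add_sub]
  rfl

theorem operatorGraph_eq_range (i : D →L[𝕜] B) {A : ℝ → D →L[𝕜] B}
    (hA : UnifBoundedStronglyCont A) (ν : Measure ℝ) [IsFiniteMeasure ν] :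
    operatorGraph i A ν = range fun f => (inclCLM i f, operatorCLM i hA ν f) := by
  ext ⟨p, q⟩
  constructor
  · rintro ⟨f, rfl, hq⟩
    refine ⟨f, Prod.ext rfl (ZeroAtInftyContinuousMap.ext fun x => ?_)⟩
    rw [operatorCLM_apply]
    exact (hq x).symm
  · rintro ⟨f, hf⟩
    obtain ⟨rfl, rfl⟩ := Prod.ext_iff.1 hf
    exact ⟨f, rfl, operatorCLM_apply i hA ν f⟩

theorem isSolution_iff (i : D →L[𝕜] B) {A : ℝ → D →L[𝕜] B} (hA : UnifBoundedStronglyCont A)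
    (ν : Measure ℝ) [IsFiniteMeasure ν] {Y : C₀(ℝ, D)} {u : ℝ≥0 → C₀(ℝ, D)} :
    IsSolution i A ν Y u ↔ u 0 = Y ∧ ∀ t : ℝ≥0, HasDerivWithinAt
      (fun s : ℝ => inclCLM i (u s.toNNReal)) (operatorCLM i hA ν (u t)) (Ici 0) t := by
  refine and_congr_right fun _ => forall_congr' fun t => ⟨?_, fun h =>
    ⟨_, operatorCLM_apply i hA ν (u t), h⟩⟩
  rintro ⟨g, hg, hd⟩
  have : g = operatorCLM i hA ν (u t) := ZeroAtInftyContinuousMap.ext fun x => by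
    rw [hg, operatorCLM_apply]
  exact this ▸ hd

variable [NormedSpace ℝ D] {i : D →L[𝕜] B} {A : ℝ → D →L[𝕜] B}
  {S : ℝ → ℝ≥0 → B →L[𝕜] B} {SD : ℝ → ℝ≥0 → D →L[𝕜] D}

/-- The semigroup generated by `A(·) - D₊^(ν)`. -/
def pathSemigroup (h : IsRegularFamily i A S SD) (ν : Measure ℝ) [IsFiniteMeasure ν] :
    ℝ≥0 → C₀(ℝ, B) →L[𝕜] C₀(ℝ, B) :=
  expScale (ν.real univ) (perturb h.isC0Semigroup_mulSemigroup (convC₀ 𝕜 ν))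

theorem isC0Semigroup_pathSemigroup (h : IsRegularFamily i A S SD) (ν : Measure ℝ)
    [IsFiniteMeasure ν] : IsC0Semigroup (pathSemigroup h ν) :=
  isC0Semigroup_expScale _ (isC0Semigroup_perturb _)

theorem mem_generatorGraph_pathSemigroup (h : IsRegularFamily i A S SD) (ν : Measure ℝ)
    [IsFiniteMeasure ν] (f : C₀(ℝ, D)) :
    (inclCLM i f, operatorCLM i h.bdd_A ν f) ∈ generatorGraph (pathSemigroup h ν) := by
  have := mem_generatorGraph_expScale (ν.real univ)
    (isC0Semigroup_perturb (N := convC₀ 𝕜 ν) h.isC0Semigroup_mulSemigroup)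
    (mem_generatorGraph_perturb h.isC0Semigroup_mulSemigroup (h.mem_generatorGraph_mulSemigroup f))
  rwa [RCLike.real_smul_eq_coe_smul (K := 𝕜)] at this

/-- `C₀(ℝ, D)` is invariant if the restricted semigroups in `D` form a regular family. -/
theorem inclCLM_pathSemigroup [CompleteSpace D] {Dt : Type*} [NormedAddCommGroup Dt]
    [NormedSpace 𝕜 Dt] [NormedSpace ℝ Dt] {j : Dt →L[𝕜] D} {A₁ : ℝ → Dt →L[𝕜] D}
    {SDt : ℝ → ℝ≥0 → Dt →L[𝕜] Dt} (h : IsRegularFamily i A S SD)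
    (h' : IsRegularFamily j A₁ SD SDt) (ν : Measure ℝ) [IsFiniteMeasure ν] (t : ℝ≥0)
    (f : C₀(ℝ, D)) : inclCLM i (pathSemigroup h' ν t f) = pathSemigroup h ν t (inclCLM i f) := by
  rw [pathSemigroup, pathSemigroup, expScale_apply, expScale_apply,
    ContinuousLinearMap.map_smul_of_tower]
  congr 1
  exact perturb_intertwine h.isC0Semigroup_mulSemigroup h'.isC0Semigroup_mulSemigroup
    (fun t f => ZeroAtInftyContinuousMap.ext fun x => h.restrict x t (f x))
    (inclCLM_convC₀ i ν) t f

/-- Both sides are sums over the number of jumps of the same terms, so uniqueness of sums suffices.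
-/
theorem pathSemigroup_apply_eq_integral (h : IsRegularFamily i A S SD) (ν : Measure ℝ)
    [IsFiniteMeasure ν] (Y : C₀(ℝ, B)) (t : ℝ≥0) (x : ℝ) :
    pathSemigroup h ν t Y x =
      ∫ p : PC (t : ℝ), p.chronExp S x (Y (p.path x t)) ∂pathLaw ν t := by
  have h1 := (integral_pathLaw ν h.continuous_uncurry h.bdd Y t.coe_nonneg x).2
  simp only [← dyson_apply_eq_integral h ν Y _ t.coe_nonneg x] at h1
  have h2 := ((hasSum_perturb (N := convC₀ 𝕜 ν) h.isC0Semigroup_mulSemigroup t.coe_nonneg Y).mapL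
    (evalC₀ 𝕜 x)).const_smul (Real.exp (-(t * ν.real univ)))
  rw [Real.toNNReal_coe] at h2
  rw [← h2.unique h1, pathSemigroup, expScale_apply, mul_comm]
  rfl

end MainConstruction

end ChronPath

end

/-! ### The main theorem -/

open ChronPath
theorem mainTheorem9 {𝕜 B D Dt : Type*} [RCLike 𝕜]
    [NormedAddCommGroup B] [NormedSpace 𝕜 B] [NormedSpace ℝ B] [IsScalarTower ℝ 𝕜 B]
    [CompleteSpace B]
    [NormedAddCommGroup D] [NormedSpace 𝕜 D] [CompleteSpace D]
    [NormedAddCommGroup Dt] [NormedSpace 𝕜 Dt] [CompleteSpace Dt]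
    (j : Dt →L[𝕜] D) (i : D →L[𝕜] B) (hspaces : ThreeSpaces j i)
    (A : ℝ → D →L[𝕜] B) (A₁ : ℝ → Dt →L[𝕜] D)
    (S : ℝ → ℝ≥0 → B →L[𝕜] B) (SD : ℝ → ℝ≥0 → D →L[𝕜] D) (SDt : ℝ → ℝ≥0 → Dt →L[𝕜] Dt)
    (hA : GeneratingFamily j i A A₁ S SD SDt)
    (ν : Measure ℝ) [IsFiniteMeasure ν] (hν : ν (Iic 0) = 0) :
    (∀ t : ℝ≥0, IsProbabilityMeasure (pathLaw ν t)) ∧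
    ∃ Φ : ℝ≥0 → C₀(ℝ, B) →L[𝕜] C₀(ℝ, B),
      -- `Φ` is the strongly continuous semigroup generated by `A(·) - D₊^(ν)`, with core `C₀(ℝ, D)`
      (IsC0Semigroup Φ ∧ generatorGraph Φ = closure (operatorGraph i A ν)) ∧
      (∀ Ψ : ℝ≥0 → C₀(ℝ, B) →L[𝕜] C₀(ℝ, B), IsC0Semigroup Ψ →
        generatorGraph Ψ = closure (operatorGraph i A ν) → Ψ = Φ) ∧
      -- it yields the unique solution of the Cauchy problem
      (∀ Y : C₀(ℝ, D), ∃ u : ℝ≥0 → C₀(ℝ, D), IsSolution i A ν Y u ∧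
        (∀ t, inclC₀ i (u t) = Φ t (inclC₀ i Y)) ∧
        ∀ v : ℝ≥0 → C₀(ℝ, D), IsSolution i A ν Y v → v = u) ∧
      -- the path integral representation
      (∀ (Y : C₀(ℝ, B)) (t : ℝ≥0) (x : ℝ),
        Integrable (fun p : PC (t : ℝ) => p.chronExp S x (Y (p.path x t))) (pathLaw ν t) ∧
        Φ t Y x = ∫ p : PC (t : ℝ), p.chronExp S x (Y (p.path x t)) ∂(pathLaw ν t)) := by
  let : NormedSpace ℝ D := NormedSpace.restrictScalars ℝ 𝕜 D
  let : NormedSpace ℝ Dt := NormedSpace.restrictScalars ℝ 𝕜 Dt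
  -- The construction is used twice, for `D ⊂ B` and for `Dt ⊂ D`; the second run gives the
  -- invariance of `C₀(ℝ, D)`.
  have h : IsRegularFamily i A S SD :=
    { dense := DenseRange.of_comp hspaces.dense_B
      bdd_A := hA.bdd_A
      semigroup := hA.semigroup_B
      bdd := hA.bdd_B
      gen := fun x d => hA.core_B x ▸ subset_closure (mem_range_self d)
      restrict := hA.restrict_D
      bdd' := hA.bdd_D }
  have h' : IsRegularFamily j A₁ SD SDt :=
    { dense := hspaces.dense_D
      bdd_A := hA.bdd_A₁
      semigroup := hA.semigroup_D
      bdd := hA.bdd_D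
      gen := fun x d => hA.core_D x ▸ subset_closure (mem_range_self d)
      restrict := hA.restrict_Dt
      bdd' := hA.bdd_Dt }
  have hΦ := isC0Semigroup_pathSemigroup h ν
  have hgen := mem_generatorGraph_pathSemigroup h ν
  have hinv := inclCLM_pathSemigroup h h' ν
  have hd := denseRange_inclCLM h.dense
  have hG : generatorGraph (pathSemigroup h ν) = closure (operatorGraph i A ν) := by
    rw [operatorGraph_eq_range i hA.bdd_A]
    exact generatorGraph_eq_closure_of_invariant hΦ hd hinv hgen
  refine ⟨fun t => ⟨pathLaw_univ ν t.coe_nonneg⟩, pathSemigroup h ν, ⟨hΦ, hG⟩,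
    fun Ψ hΨ hΨG => ?_, fun Y => ⟨fun t => pathSemigroup h' ν t Y, ?_, fun t => hinv t Y,
    fun v hv => ?_⟩, fun Y t x => ⟨(integral_pathLaw ν h.continuous_uncurry h.bdd Y
      t.coe_nonneg x).1, pathSemigroup_apply_eq_integral h ν Y t x⟩⟩
  · refine (hΦ.eq_of_generatorGraph_eq hΨ (hG.trans hΨG.symm) hd ?_).symm
    rintro _ ⟨f, rfl⟩
    exact ⟨_, hgen f⟩
  · refine (isSolution_iff i hA.bdd_A ν).2
      ⟨(isC0Semigroup_pathSemigroup h' ν).zero_apply Y, fun t => ?_⟩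
    have h1 := hasDerivWithinAt_Ici_apply hΦ (hgen Y) t.coe_nonneg
    have h2 := hgen (pathSemigroup h' ν t Y)
    rw [hinv] at h2
    -- The generator commutes with its semigroup; this rewrites the derivative of the orbit as the
    -- operator applied to the current state.
    have h3 : pathSemigroup h ν t (operatorCLM i hA.bdd_A ν Y) =
        operatorCLM i hA.bdd_A ν (pathSemigroup h' ν t Y) :=
      tendsto_nhds_unique (map_mem_generatorGraph hΦ (hgen Y) t) h2
    rw [Real.toNNReal_coe, h3] at h1
    simpa only [hinv] using h1
  · obtain ⟨h0, hv⟩ := (isSolution_iff i hA.bdd_A ν).1 hv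
    funext t
    -- A solution is differentiable only in the norm of `C₀(ℝ, B)`, so the comparison is made there
    -- and injectivity of `i` brings it back to `D`.
    refine ZeroAtInftyContinuousMap.ext fun x => hspaces.inj_i ?_
    have hv' : ∀ s ∈ Ici (0 : ℝ), HasDerivWithinAt (fun s : ℝ => inclCLM i (v s.toNNReal))
        (operatorCLM i hA.bdd_A ν (v s.toNNReal)) (Ici 0) s := fun s hs => by
      have := hv s.toNNReal
      rwa [Real.coe_toNNReal s hs] at this
    have h1 := eq_apply_of_hasDerivWithinAt hΦ (v := fun s : ℝ => inclCLM i (v s.toNNReal))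
      t.coe_nonneg (fun s hs => (hv' s hs.1).continuousWithinAt.mono Icc_subset_Ici_self)
      (fun s hs => (hv' s hs.1).mono fun r hr => le_trans hs.1 (le_of_lt hr))
      (fun s _ => hgen _)
    simp only [Real.toNNReal_coe, Real.toNNReal_zero, h0] at h1
    rw [← hinv] at h1
    exact DFunLike.congr_fun h1 x
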